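/- **Setting and definitions.** Let $\mathcal H=\mathcal H_1\otimes\mathcal H_2$ be the (completed) tensor product of two complex Hilbert spaces, of finite or infinite dimension. For subspaces $\mathcal Y,\mathcal Z\subset\mathcal H$ and real $\delta$, write $\mathcal Y\approx_\delta\mathcal Z$ if $\langle z|P_{\mathcal Y^\perp}|z\rangle\le\delta$ for every unit vector $z\in\mathcal Z$ and $\langle y|P_{\mathcal Z^\perp}|y\rangle\le\delta$ for every unit vector $y\in\mathcal Y$, where $P_{\mathcal W}$ denotes the orthogonal projection onto $\mathcal W$. For $\sigma\ge0$ and a natural number $r$, a bounded operator $K$ on $\mathcal H$ is a *$(\sigma,r)$-AGSP with target space $\mathcal Y$* if (1) $K|y\rangle=|y\rangle$ for all $|y\rangle\in\mathcal Y$; (2) $\|K|\phi\rangle\|\le\sigma$ for every unit vector $|\phi\rangle$ orthogonal to $\mathcal Y$; (3) $K=\sum_{j=1}^{r}A_j\otimes B_j$ for some bounded operators $A_j$ on $\mathcal H_1$ and $B_j$ on $\mathcal H_2$. The entanglement entropy of a unit vector $|\psi\rangle\in\mathcal H$ is $S(\psi)=-\operatorname{Tr}\rho\log\rho\in[0,\infty]$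 with $\rho=\operatorname{Tr}_{\mathcal H_2}|\psi\rangle\langle\psi|$, i.e. $S(\psi)=-\sum_i\lambda_i\log\lambda_i$, where the $\lambda_i$ are the eigenvalues of $\rho$ counted with multiplicity (the squared Schmidt coefficients of $\psi$). **Lemma.** For every real $M$ there is a constant $C$, depending only on $M$, such that the following holds for all complex Hilbert spaces $\mathcal H_1,\mathcal H_2$. Let $\mathcal Z$ be a finite-dimensional subspace of $\mathcal H=\mathcal H_1\otimes\mathcal H_2$, and let $(\tilde{\mathcal Z}_n)_{n\ge0}$ be subspaces of $\mathcal H$ with $\tilde{\mathcal Z}_n\approx_{\delta_n}\mathcal Z$ for all $n$, where $\sum_{n=0}^\infty n\,\delta_n$ converges and is at most $M$. Let $R\ge1$ be an integer, put $\sigma=\frac1{2R}$, and suppose that there are operators $K_1,K_2,\dots$ such that, for each $n\ge1$, $K_n$ is a $(\sigma^n,R^n)$-AGSP with target space $\tilde{\mathcal Z}_n$. Then every unit vector $|\psi\rangle\in\mathcal Z$ has entanglement entropy $$S(\psi)\le C\,\bigl(\log R+\log\dim\mathcal Z\bigr).$$ -/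

import Mathlib

open scoped TensorProduct InnerProductSpace

universe u v

noncomputable section

/-- The bipartite Hilbert space `H₁ ⊗ H₂`: the Hilbert-space completion of the algebraic tensor
product, whose inner product satisfies `⟪a ⊗ b, c ⊗ d⟫ = ⟪a, c⟫ * ⟪b, d⟫`. -/
abbrev Bipartite (H₁ : Type u) (H₂ : Type v)
    [NormedAddCommGroup H₁] [InnerProductSpace ℂ H₁]
    [NormedAddCommGroup H₂] [InnerProductSpace ℂ H₂] : Type (max u v) :=
  UniformSpace.Completion (H₁ ⊗[ℂ] H₂)

namespace Bipartite

section

variable {H₁ : Type u} {H₂ : Type v}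
  [NormedAddCommGroup H₁] [InnerProductSpace ℂ H₁]
  [NormedAddCommGroup H₂] [InnerProductSpace ℂ H₂]

/-- The product vector `x ⊗ y`, as a continuous bilinear map into the bipartite space. -/
def tmulL (H₁ : Type u) (H₂ : Type v)
    [NormedAddCommGroup H₁] [InnerProductSpace ℂ H₁]
    [NormedAddCommGroup H₂] [InnerProductSpace ℂ H₂] :
    H₁ →L[ℂ] H₂ →L[ℂ] Bipartite H₁ H₂ :=
  (ContinuousLinearMap.compL ℂ H₂ (H₁ ⊗[ℂ] H₂) (Bipartite H₁ H₂)
    UniformSpace.Completion.toComplL).comp (TensorProduct.mkL ℂ H₁ H₂)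

theorem tmulL_apply (x : H₁) (y : H₂) :
    tmulL H₁ H₂ x y = ((x ⊗ₜ[ℂ] y : H₁ ⊗[ℂ] H₂) : Bipartite H₁ H₂) := rfl

/-- The bounded operator `A ⊗ B` on the bipartite space. -/
def tensorOp (A : H₁ →L[ℂ] H₁) (B : H₂ →L[ℂ] H₂) :
    Bipartite H₁ H₂ →L[ℂ] Bipartite H₁ H₂ :=
  (TensorProduct.mapL A B).completion

theorem tensorOp_tmulL (A : H₁ →L[ℂ] H₁) (B : H₂ →L[ℂ] H₂) (x : H₁) (y : H₂) :
    tensorOp A B (tmulL H₁ H₂ x y) = tmulL H₁ H₂ (A x) (B y) := by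
  simp [tensorOp, tmulL_apply]

/-- `𝒴` is `δ`-viable for `𝒵`: `⟨z| P_{𝒴^⊥} |z⟩ ≤ δ` for all unit vectors `z ∈ 𝒵`.
(The orthogonal complement of any subspace is closed, so that its orthogonal projection exists.) -/
def IsViable {E : Type u} [NormedAddCommGroup E] [InnerProductSpace ℂ E] [CompleteSpace E]
    (δ : ℝ) (Y Z : Submodule ℂ E) : Prop :=
  ∀ z ∈ Z, ‖z‖ = 1 → (⟪z, Yᗮ.starProjection z⟫_ℂ).re ≤ δ

/-- `𝒴 ≈_δ 𝒵`: each of the two subspaces is `δ`-viable for the other one. -/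
def ApproxEq {E : Type u} [NormedAddCommGroup E] [InnerProductSpace ℂ E] [CompleteSpace E]
    (δ : ℝ) (Y Z : Submodule ℂ E) : Prop :=
  IsViable δ Y Z ∧ IsViable δ Z Y

/-- `K` is a `(σ, r)`-AGSP with target space `Y`: it fixes every vector of the target space,
shrinks every unit vector orthogonal to the target space to norm at most `σ`, and is a sum of `r`
product operators. -/
structure IsAGSP (σ : ℝ) (r : ℕ) (Y : Submodule ℂ (Bipartite H₁ H₂))
    (K : Bipartite H₁ H₂ →L[ℂ] Bipartite H₁ H₂) : Prop where
  fixes : ∀ y ∈ Y, K y = y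
  shrinks : ∀ φ ∈ Yᗮ, ‖φ‖ = 1 → ‖K φ‖ ≤ σ
  rank : ∃ (A : Fin r → H₁ →L[ℂ] H₁) (B : Fin r → H₂ →L[ℂ] H₂), K = ∑ j, tensorOp (A j) (B j)

variable [CompleteSpace H₁] [CompleteSpace H₂]

/-- The antilinear map `H₁ → H₂`, `x ↦ (⟨x| ⊗ 1) ψ`, that is, `⟪sliceLeft ψ x, y⟫ = ⟪ψ, x ⊗ y⟫`. -/
def sliceLeft (ψ : Bipartite H₁ H₂) : H₁ →L⋆[ℂ] H₂ :=
  (InnerProductSpace.toDual ℂ H₂).symm.toContinuousLinearEquiv.toContinuousLinearMap.comp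
    ((ContinuousLinearMap.compL ℂ H₂ (Bipartite H₁ H₂) ℂ (innerSL ℂ ψ)).comp (tmulL H₁ H₂))

/-- The antilinear map `H₂ → H₁`, `y ↦ (1 ⊗ ⟨y|) ψ`, that is, `⟪sliceRight ψ y, x⟫ = ⟪ψ, x ⊗ y⟫`. -/
def sliceRight (ψ : Bipartite H₁ H₂) : H₂ →L⋆[ℂ] H₁ :=
  (InnerProductSpace.toDual ℂ H₁).symm.toContinuousLinearEquiv.toContinuousLinearMap.comp
    ((ContinuousLinearMap.compL ℂ H₂ (Bipartite H₁ H₂) ℂ (innerSL ℂ ψ)).comp (tmulL H₁ H₂)).flip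

theorem inner_sliceLeft (ψ : Bipartite H₁ H₂) (x : H₁) (y : H₂) :
    ⟪sliceLeft ψ x, y⟫_ℂ = ⟪ψ, tmulL H₁ H₂ x y⟫_ℂ := by
  simp [sliceLeft]

theorem inner_sliceRight (ψ : Bipartite H₁ H₂) (x : H₁) (y : H₂) :
    ⟪sliceRight ψ y, x⟫_ℂ = ⟪ψ, tmulL H₁ H₂ x y⟫_ℂ := by
  simp [sliceRight]

/-- The reduced density operator `Tr_{H₂} |ψ⟩⟨ψ|` on `H₁`; see `hasSum_reducedDensity` for the
partial trace formula. -/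
def reducedDensity (ψ : Bipartite H₁ H₂) : H₁ →L[ℂ] H₁ :=
  (sliceRight ψ).comp (sliceLeft ψ)

/-- The matrix elements of the reduced density operator are those of the partial trace:
`⟨x'| ρ |x⟩ = ∑ᵢ ⟨x' ⊗ eᵢ|ψ⟩⟨ψ|x ⊗ eᵢ⟩` for every Hilbert basis `e` of `H₂`. -/
theorem hasSum_reducedDensity {ι : Type*} (e : HilbertBasis ι ℂ H₂) (ψ : Bipartite H₁ H₂)
    (x' x : H₁) :
    HasSum (fun i => ⟪tmulL H₁ H₂ x' (e i), ψ⟫_ℂ * ⟪ψ, tmulL H₁ H₂ x (e i)⟫_ℂ)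
      ⟪x', reducedDensity ψ x⟫_ℂ := by
  have h := e.hasSum_inner_mul_inner (sliceLeft ψ x) (sliceLeft ψ x')
  have h1 : ⟪x', reducedDensity ψ x⟫_ℂ = ⟪sliceLeft ψ x, sliceLeft ψ x'⟫_ℂ := by
    rw [← inner_conj_symm x', ← inner_conj_symm (sliceLeft ψ x), inner_sliceLeft]
    simp only [reducedDensity, ContinuousLinearMap.comp_apply]
    rw [inner_sliceRight]
  rw [h1]
  refine h.congr_fun ?_
  intro i
  rw [inner_sliceLeft, ← inner_conj_symm (e i), inner_sliceLeft, inner_conj_symm, mul_comm]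

/-- The entanglement entropy of a unit vector `ψ`: the von Neumann entropy `-Tr ρ log ρ` of its
reduced density operator `ρ`, i.e. the sum of `-μ log μ` over the eigenvalues `μ` of `ρ` (the
squares of the Schmidt coefficients of `ψ`), counted with multiplicity.  As `ρ` is positive and of
trace one, its eigenvalues lie in `[0, 1]`, and the nonzero ones exhaust the trace and have finite
multiplicity; the term with `μ = 0` vanishes.  The value may be `∞`. -/
def entanglementEntropy (ψ : Bipartite H₁ H₂) : ENNReal :=
  ∑' μ : ℝ,
    (Module.finrank ℂ (Module.End.eigenspace (reducedDensity ψ).toLinearMap (μ : ℂ)) : ENNReal) *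
      ENNReal.ofReal (Real.negMulLog μ)

end

end Bipartite

end

/-! The entropy is controlled by approximating `ψ` with vectors of Schmidt rank `S₀ * R ^ n`, where
`log S₀ = O(log R + log dim Z)` for fixed `M` and the squared errors are summable. By Eckart-Young
(`sum_tail_eigenvalues_le`), the eigenvalues of the reduced density beyond the first `S₀ * R ^ n`
then sum to at most the `n`-th squared error. Since `log (i + 1)` is at most `log S₀` plus `log R`
times the number of thresholds that `i` has passed, the mean of `log (i + 1)` is at most `log S₀ +
O(log R)`, and Gibbs' inequality turns this into an entropy bound.

The starting rank `S₀` comes from a single AGSP. Summability gives an index `n₀ ≤ 64 * M + 1` with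
`δ n₀ ≤ 1 / 64`; let `Y` be its target space. The powers of `K n₀` converge to an oblique projection
`Φ` onto `Y`. A basis of `Y` made of images under `Φ` of product vectors, with nearly maximal
determinant, lifts `Y` linearly to Schmidt rank `dim Y`; a power `K n₀ ^ m` brings the lift close to
the inclusion (`IsAGSP.exists_lift`). The norm of the lift is bounded self-consistently: its image
under `K n₀ ^ m` has small rank, so it is an efficient sum of products, whose coordinates are
bounded. This closes because `σ ^ 2 * R = 1 / (4 * R) < 1`.

For any other `n` with `δ n ≤ 1 / 64`, the spaces `Y` and `W = Z' n` are close, so the lift contains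
a vector `v` of norm at most 3 with the same projection onto `W` as `ψ`. Applying `K n` fixes that
projection and shrinks the rest, at the price of a factor `R ^ n` in rank (`exists_approx_of_lift`).
-/

namespace Bipartite

/-! ### Product vectors and Schmidt rank -/

section TensorBasics

variable {H₁ : Type u} {H₂ : Type v}
  [NormedAddCommGroup H₁] [InnerProductSpace ℂ H₁]
  [NormedAddCommGroup H₂] [InnerProductSpace ℂ H₂]

theorem inner_tmulL (a c : H₁) (b d : H₂) :
    ⟪tmulL H₁ H₂ a b, tmulL H₁ H₂ c d⟫_ℂ = ⟪a, c⟫_ℂ * ⟪b, d⟫_ℂ := by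
  rw [tmulL_apply, tmulL_apply, UniformSpace.Completion.inner_coe, TensorProduct.inner_tmul]

theorem norm_tmulL (a : H₁) (b : H₂) : ‖tmulL H₁ H₂ a b‖ = ‖a‖ * ‖b‖ := by
  rw [tmulL_apply, UniformSpace.Completion.norm_coe, TensorProduct.norm_tmul]

/-- The product vectors span a dense subspace. -/
theorem dense_span_tmulL :
    Dense (Submodule.span ℂ {t : Bipartite H₁ H₂ | ∃ a b, tmulL H₁ H₂ a b = t} :
      Set (Bipartite H₁ H₂)) := by
  refine UniformSpace.Completion.denseRange_coe.mono ?_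
  rintro _ ⟨t, rfl⟩
  have ht : t ∈ Submodule.span ℂ {t : H₁ ⊗[ℂ] H₂ | ∃ m n, m ⊗ₜ[ℂ] n = t} := by
    rw [TensorProduct.span_tmul_eq_top]; trivial
  induction ht using Submodule.span_induction with
  | mem x hx =>
    obtain ⟨a, b, rfl⟩ := hx
    exact Submodule.subset_span ⟨a, b, rfl⟩
  | zero => rw [UniformSpace.Completion.coe_zero]; exact Submodule.zero_mem _
  | add x y _ _ hx hy =>
    rw [UniformSpace.Completion.coe_add]; exact Submodule.add_mem _ hx hy
  | smul c x _ hx =>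
    rw [UniformSpace.Completion.coe_smul]; exact Submodule.smul_mem _ c hx

/-- `u` is a sum of at most `S` product vectors, i.e. its Schmidt rank is at most `S`. -/
def HasSchmidtRank (S : ℕ) (u : Bipartite H₁ H₂) : Prop :=
  ∃ (ι : Type) (_ : Fintype ι) (x : ι → H₁) (y : ι → H₂),
    Fintype.card ι ≤ S ∧ u = ∑ k, tmulL H₁ H₂ (x k) (y k)

theorem HasSchmidtRank.mono {S S' : ℕ} {u : Bipartite H₁ H₂} (h : HasSchmidtRank S u)
    (hS : S ≤ S') : HasSchmidtRank S' u := by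
  obtain ⟨ι, _, x, y, hc, hu⟩ := h
  exact ⟨ι, inferInstance, x, y, hc.trans hS, hu⟩

theorem hasSchmidtRank_zero : HasSchmidtRank 0 (0 : Bipartite H₁ H₂) :=
  ⟨Empty, inferInstance, fun _ => 0, fun _ => 0, by simp, by simp⟩

theorem HasSchmidtRank.sum_tensorOp {S r : ℕ} {u : Bipartite H₁ H₂} (h : HasSchmidtRank S u)
    (A : Fin r → H₁ →L[ℂ] H₁) (B : Fin r → H₂ →L[ℂ] H₂) :
    HasSchmidtRank (S * r) ((∑ j, tensorOp (A j) (B j)) u) := by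
  obtain ⟨ι, _, x, y, hc, rfl⟩ := h
  refine ⟨ι × Fin r, inferInstance, fun p => A p.2 (x p.1), fun p => B p.2 (y p.1), ?_, ?_⟩
  · simpa using Nat.mul_le_mul_right r hc
  · simp only [map_sum, sum_apply, tensorOp_tmulL, Fintype.sum_prod_type]

theorem IsAGSP.hasSchmidtRank {σ : ℝ} {r S : ℕ} {Y : Submodule ℂ (Bipartite H₁ H₂)}
    {K : Bipartite H₁ H₂ →L[ℂ] Bipartite H₁ H₂} (hK : IsAGSP σ r Y K)
    {u : Bipartite H₁ H₂} (h : HasSchmidtRank S u) : HasSchmidtRank (S * r) (K u) := by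
  obtain ⟨A, B, hAB⟩ := hK.rank
  rw [hAB]
  exact h.sum_tensorOp A B

theorem IsAGSP.hasSchmidtRank_pow {σ : ℝ} {r S : ℕ} {Y : Submodule ℂ (Bipartite H₁ H₂)}
    {K : Bipartite H₁ H₂ →L[ℂ] Bipartite H₁ H₂} (hK : IsAGSP σ r Y K)
    {u : Bipartite H₁ H₂} (h : HasSchmidtRank S u) (m : ℕ) :
    HasSchmidtRank (S * r ^ m) ((K ^ m) u) := by
  induction m with
  | zero => simpa using h
  | succ m ih =>
    have := hK.hasSchmidtRank ih
    rwa [mul_assoc, ← pow_succ, ← mul_apply_eq_comp, ← pow_succ'] at this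

/-- A vector of Schmidt rank at most `S` has an expansion in at most `S` product vectors with
orthonormal left factors. -/
theorem HasSchmidtRank.exists_orthonormal {S : ℕ} {u : Bipartite H₁ H₂} (h : HasSchmidtRank S u) :
    ∃ (s : ℕ) (e : Fin s → H₁) (y : Fin s → H₂), s ≤ S ∧ Orthonormal ℂ e ∧
      u = ∑ k, tmulL H₁ H₂ (e k) (y k) := by
  obtain ⟨ι, _, x, y, hc, rfl⟩ := h
  let X : Submodule ℂ H₁ := Submodule.span ℂ (Set.range x)
  have : FiniteDimensional ℂ X := FiniteDimensional.span_of_finite ℂ (Set.finite_range x)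
  let b := stdOrthonormalBasis ℂ X
  refine ⟨Module.finrank ℂ X, fun k => (b k : H₁),
    fun k => ∑ i, ⟪(b k : H₁), x i⟫_ℂ • y i, ?_, ?_, ?_⟩
  · exact (finrank_range_le_card x).trans hc
  · exact b.orthonormal.comp_linearIsometry X.subtypeₗᵢ
  · have hx : ∀ i, x i = ∑ k, ⟪(b k : H₁), x i⟫_ℂ • (b k : H₁) := by
      intro i
      have := congrArg Subtype.val
        (b.sum_repr' (⟨x i, Submodule.subset_span ⟨i, rfl⟩⟩ : X))
      simpa using this.symm
    simp only [map_sum, map_smul]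
    rw [Finset.sum_comm]
    refine Finset.sum_congr rfl fun i _ => ?_
    conv_lhs => rw [hx i]
    simp

/-- A vector of Schmidt rank at most `S` is a sum of at most `S` product vectors whose norms add
up to at most `√S` times its norm. -/
theorem HasSchmidtRank.exists_sum_norm_le {S : ℕ} {u : Bipartite H₁ H₂}
    (h : HasSchmidtRank S u) :
    ∃ (s : ℕ) (e : Fin s → H₁) (y : Fin s → H₂), u = ∑ k, tmulL H₁ H₂ (e k) (y k) ∧
      ∑ k, ‖e k‖ * ‖y k‖ ≤ √S * ‖u‖ := by
  obtain ⟨s, e, y, hs, he, hu⟩ := h.exists_orthonormal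
  refine ⟨s, e, y, hu, ?_⟩
  -- Orthonormal left factors make the terms pairwise orthogonal, whatever the right factors are;
  -- Cauchy-Schwarz then costs only `√s`.
  have hn : ‖u‖ ^ 2 = ∑ k, ‖y k‖ ^ 2 := by
    have h1 : ⟪u, u⟫_ℂ = ∑ k, ⟪y k, y k⟫_ℂ := by
      conv_lhs => rw [hu]
      simp only [sum_inner, inner_sum, inner_tmulL, orthonormal_iff_ite.mp he]
      simp
    simp only [inner_self_eq_norm_sq_to_K] at h1
    exact_mod_cast h1
  simp only [he.norm_eq_one, one_mul]
  have h2 : (∑ k, ‖y k‖) ^ 2 ≤ s * ∑ k, ‖y k‖ ^ 2 := by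
    simpa using sq_sum_le_card_mul_sum_sq (s := Finset.univ) (f := fun k => ‖y k‖)
  rw [← hn] at h2
  calc ∑ k, ‖y k‖ ≤ √(s * ‖u‖ ^ 2) := Real.le_sqrt_of_sq_le h2
    _ = √s * ‖u‖ := by rw [Real.sqrt_mul (by positivity), Real.sqrt_sq (norm_nonneg _)]
    _ ≤ √S * ‖u‖ := by gcongr

end TensorBasics

end Bipartite

/-! ### Bases of nearly maximal determinant -/

section Spanner

/-- In a spanning bounded subset of a finite-dimensional space there is a basis in which all
elements of the subset have coordinates of modulus at most two. -/
theorem exists_basis_mem_norm_repr_le_two {V : Type*} [NormedAddCommGroup V] [NormedSpace ℂ V]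
    [FiniteDimensional ℂ V] {F : Set V} (hF : Submodule.span ℂ F = ⊤)
    (hb : Bornology.IsBounded F) :
    ∃ p : Module.Basis (Fin (Module.finrank ℂ V)) ℂ V,
      (∀ i, p i ∈ F) ∧ ∀ x ∈ F, ∀ i, ‖p.repr x i‖ ≤ 2 := by
  classical
  set d := Module.finrank ℂ V
  obtain ⟨s, hsF, hspan, hli⟩ := exists_linearIndependent ℂ F
  let b₀ : Module.Basis s ℂ V := Module.Basis.mk hli (by simp [hspan, hF])
  have : Fintype s := FiniteDimensional.fintypeBasisIndex b₀
  have hcard : Fintype.card s = d := (Module.finrank_eq_card_basis b₀).symm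
  let b : Module.Basis (Fin d) ℂ V := b₀.reindex (Fintype.equivFinOfCardEq hcard)
  have hbF : ∀ i, b i ∈ F := fun i => by simpa [b, b₀] using hsF (Subtype.coe_prop _)
  -- `F` need not be closed, so the supremum of the determinants may not be attained. A family
  -- within a factor two of it is enough, and is the source of the constant two.
  let D : Set ℝ := {t | ∃ w : Fin d → V, (∀ i, w i ∈ F) ∧ ‖b.det w‖ = t}
  have hDne : D.Nonempty := ⟨_, b, hbF, rfl⟩
  have hDbdd : BddAbove D := by
    obtain ⟨C, hC⟩ := hb.exists_norm_le
    obtain ⟨B, hB0, hB⟩ := (LinearMap.toContinuousLinearMap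
      (b.equivFun : V →ₗ[ℂ] (Fin d → ℂ))).isBoundedLinearMap.bound
    refine ⟨d.factorial • (B * C) ^ d, ?_⟩
    rintro _ ⟨w, hw, rfl⟩
    rw [b.det_apply]
    have := Matrix.det_le (A := b.toMatrix w) (abv := NormedField.toAbsoluteValue ℂ)
      (x := B * C) (fun i j => ?_)
    · rw [Fintype.card_fin] at this
      exact this
    · have hB1 : ‖b.equivFun (w j)‖ ≤ B * ‖w j‖ := hB (w j)
      have h1 : ‖b.equivFun (w j) i‖ ≤ ‖b.equivFun (w j)‖ := norm_le_pi_norm _ i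
      calc _ = ‖b.equivFun (w j) i‖ := rfl
        _ ≤ B * ‖w j‖ := h1.trans hB1
        _ ≤ B * C := by gcongr; exact hC _ (hw j)
  have hpos : 0 < sSup D := by
    refine lt_of_lt_of_le one_pos (le_csSup hDbdd ⟨b, hbF, ?_⟩)
    simp [b.det_self]
  obtain ⟨_, ⟨w, hwF, rfl⟩, hw⟩ := exists_lt_of_lt_csSup hDne (half_lt_self hpos)
  have hw0 : b.det w ≠ 0 := fun h => by rw [h, norm_zero] at hw; linarith
  obtain ⟨hli', hsp'⟩ := (b.is_basis_iff_det (v := w)).2 (isUnit_iff_ne_zero.2 hw0)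
  refine ⟨Module.Basis.mk hli' hsp'.ge, fun i => by simpa using hwF i, fun x hx i => ?_⟩
  -- Cramer's rule: a coordinate of `x` is the ratio of the determinant with `x` substituted to that
  -- of `w`.
  have h1 := b.det_smul_mk_coord_eq_det_update hli' hsp'.ge i
  have h2 := congrArg (fun f => ‖f x‖) h1
  have h3 : ‖b.det (Function.update w i x)‖ ≤ sSup D := by
    refine le_csSup hDbdd ⟨_, fun j => ?_, rfl⟩
    by_cases hj : j = i
    · subst hj; simpa using hx
    · simpa [Function.update_of_ne hj] using hwF j
  have h4 : ‖b.det w‖ * ‖(Module.Basis.mk hli' hsp'.ge).repr x i‖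
      = ‖b.det (Function.update w i x)‖ := by simpa using h2
  nlinarith [norm_nonneg (b.det w), norm_nonneg ((Module.Basis.mk hli' hsp'.ge).repr x i)]

end Spanner

/-! ### The limit of the powers of an AGSP -/

section ObliqueProjection

variable {E : Type*} [NormedAddCommGroup E] [InnerProductSpace ℂ E] [CompleteSpace E]

/-- An operator that fixes a finite-dimensional space `Y` and shrinks the orthogonal complement
has an invariant projection onto `Y`, to which its powers converge geometrically. -/
theorem exists_invariant_projection (Y : Submodule ℂ E) [Y.HasOrthogonalProjection]
    {K : E →L[ℂ] E} {σ : ℝ} (hσ0 : 0 ≤ σ) (hσ : σ ≤ 1 / 2) (hfix : ∀ y ∈ Y, K y = y)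
    (hshr : ∀ φ ∈ Yᗮ, ‖K φ‖ ≤ σ * ‖φ‖) :
    ∃ Φ : E →L[ℂ] Y, (∀ y : Y, Φ y = y) ∧ (∀ x, Φ (K x) = Φ x) ∧
      ∀ (m : ℕ) (x : E), ‖(K ^ m) x - Φ x‖ ≤ 3 * σ ^ m * ‖x‖ := by
  set P : E →L[ℂ] E := Y.starProjection with hP
  set Q : E →L[ℂ] E := Yᗮ.starProjection with hQ
  have hPQ : ∀ x, P x + Q x = x := Y.starProjection_add_starProjection_orthogonal
  have hPm : ∀ x, P x ∈ Y := fun x => Y.starProjection_apply_mem x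
  have hQm : ∀ x, Q x ∈ Yᗮ := fun x => Yᗮ.starProjection_apply_mem x
  have hQY : ∀ y ∈ Y, Q y = 0 := fun y hy =>
    Submodule.starProjection_apply_eq_zero_iff _ |>.2 (Submodule.le_orthogonal_orthogonal _ hy)
  have hPY : ∀ y ∈ Y, P y = y := fun y hy => Submodule.starProjection_eq_self_iff.2 hy
  have hQn : ∀ x, ‖Q x‖ ≤ ‖x‖ := Yᗮ.norm_starProjection_apply_le
  set T : E →L[ℂ] E := Q * K with hT
  have hTY : ∀ y ∈ Y, T y = 0 := fun y hy => by simp [T, hfix y hy, hQY y hy]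
  have hTn : ∀ x, ‖T x‖ ≤ σ * ‖x‖ := fun x => by
    have : T x = T (Q x) := by
      conv_lhs => rw [← hPQ x, map_add, hTY _ (hPm x), zero_add]
    rw [this]
    calc ‖Q (K (Q x))‖ ≤ ‖K (Q x)‖ := hQn _
      _ ≤ σ * ‖Q x‖ := hshr _ (hQm x)
      _ ≤ σ * ‖x‖ := by gcongr; exact hQn x
  have hTn' : ‖T‖ ≤ σ := T.opNorm_le_bound hσ0 hTn
  have hT1 : ‖T‖ < 1 := by linarith
  set N : E →L[ℂ] E := ∑' i : ℕ, T ^ i with hN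
  have hN1 : ∀ x, N x - N (T x) = x := fun x => by
    have := congrArg (fun f : E →L[ℂ] E => f x) (geom_series_mul_neg T hT1)
    simpa [mul_sub] using this
  have hN2 : ∀ x, N x - T (N x) = x := fun x => by
    have := congrArg (fun f : E →L[ℂ] E => f x) (mul_neg_geom_series T hT1)
    simpa [sub_mul] using this
  have hNn : ∀ x, ‖N x‖ ≤ 2 * ‖x‖ := fun x => by
    have h1 : ‖N x‖ ≤ ‖x‖ + ‖T (N x)‖ := by
      conv_lhs => rw [← sub_add_cancel (N x) (T (N x)), hN2]
      exact norm_add_le _ _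
    have h2 := hTn (N x)
    nlinarith [norm_nonneg (N x), norm_nonneg x]
  have hNY : ∀ y ∈ Y, N y = y := fun y hy => by
    have := hN1 y
    rwa [hTY y hy, map_zero, sub_zero] at this
  -- In blocks along `Y` and `Yᗮ`, `K` is upper triangular with diagonal `1, t` and corner `b`, so
  -- `K ^ m` has corner `b (1 + t + ⋯ + t ^ (m - 1))`. The limit `P + b (1 - t)⁻¹ Q` is the operator
  -- below.
  let Φ : E →L[ℂ] Y := Y.orthogonalProjectionOnto.comp (1 + K * Q * N)
  have hΦ : ∀ x, (Φ x : E) = P (x + K (Q (N x))) := fun x => rfl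
  have hΦY : ∀ y ∈ Y, (Φ y : E) = y := fun y hy => by
    rw [hΦ, hNY y hy, hQY y hy, map_zero, add_zero, hPY y hy]
  have hΦK : ∀ x, Φ (K x) = Φ x := fun x => by
    apply Subtype.ext
    rw [hΦ, hΦ]
    have h1 : Q (N (K x)) = Q (N x) - Q x := by
      have h2 : N (K x) = P (K x) + N (T x) := by
        conv_lhs => rw [← hPQ (K x), map_add, hNY _ (hPm _)]
        rfl
      have h3 : N (T x) = N x - x := (sub_eq_iff_comm.1 (hN1 x)).symm
      rw [h2, map_add, hQY _ (hPm _), h3, zero_add, map_sub]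
    rw [h1, map_sub]
    have h4 : K x = P x + K (Q x) := by
      conv_lhs => rw [← hPQ x, map_add, hfix _ (hPm x)]
    rw [h4]
    have h5 : P x + K (Q x) + (K (Q (N x)) - K (Q x)) = P x + K (Q (N x)) := by abel
    rw [h5, map_add, map_add, hPY _ (hPm x)]
  refine ⟨Φ, fun y => Subtype.ext (hΦY y y.2), hΦK, fun m x => ?_⟩
  have hΦm : ∀ m : ℕ, Φ ((K ^ m) x) = Φ x := fun m => by
    induction m with
    | zero => simp
    | succ m ih => rw [pow_succ', mul_apply_eq_comp, hΦK, ih]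
  have hQm' : ∀ m : ℕ, ‖Q ((K ^ m) x)‖ ≤ σ ^ m * ‖x‖ := fun m => by
    induction m with
    | zero => simpa using hQn x
    | succ m ih =>
      rw [pow_succ', mul_apply_eq_comp]
      have h1 : Q (K ((K ^ m) x)) = Q (K (Q ((K ^ m) x))) := by
        conv_lhs => rw [← hPQ ((K ^ m) x), map_add, map_add, hfix _ (hPm _), hQY _ (hPm _),
          zero_add]
      rw [h1]
      calc ‖Q (K (Q ((K ^ m) x)))‖ ≤ ‖K (Q ((K ^ m) x))‖ := hQn _
        _ ≤ σ * ‖Q ((K ^ m) x)‖ := hshr _ (hQm _)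
        _ ≤ σ * (σ ^ m * ‖x‖) := by gcongr
        _ = σ ^ (m + 1) * ‖x‖ := by ring
  rw [← hΦm m]
  set z := (K ^ m) x with hz
  have h1 : z - (Φ z : E) = Q z - (Φ (Q z) : E) := by
    conv_lhs => rw [← hPQ z, map_add, Submodule.coe_add, hΦY _ (hPm z)]
    abel
  have hQQ : ‖K (Q (N (Q z)))‖ ≤ ‖Q z‖ := by
    calc _ ≤ σ * ‖Q (N (Q z))‖ := hshr _ (hQm _)
      _ ≤ σ * ‖N (Q z)‖ := by gcongr; exact hQn _
      _ ≤ σ * (2 * ‖Q z‖) := by gcongr; exact hNn _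
      _ ≤ ‖Q z‖ := by nlinarith [norm_nonneg (Q z)]
  have h2 : ‖(Φ (Q z) : E)‖ ≤ 2 * ‖Q z‖ := by
    rw [hΦ]
    calc _ ≤ ‖Q z + K (Q (N (Q z)))‖ := Y.norm_starProjection_apply_le _
      _ ≤ ‖Q z‖ + ‖K (Q (N (Q z)))‖ := norm_add_le _ _
      _ ≤ 2 * ‖Q z‖ := by linarith
  rw [h1]
  calc _ ≤ ‖Q z‖ + ‖(Φ (Q z) : E)‖ := norm_sub_le _ _
    _ ≤ 3 * ‖Q z‖ := by linarith
    _ ≤ 3 * (σ ^ m * ‖x‖) := by gcongr; exact hQm' m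
    _ = _ := by ring

end ObliqueProjection

namespace Bipartite

/-! ### Lifting the target space to low Schmidt rank -/

section Lift

variable {H₁ : Type u} {H₂ : Type v}
  [NormedAddCommGroup H₁] [InnerProductSpace ℂ H₁]
  [NormedAddCommGroup H₂] [InnerProductSpace ℂ H₂]

theorem exists_norm_le_one_smul {E : Type*} [NormedAddCommGroup E] [NormedSpace ℂ E] (a : E) :
    ∃ a' : E, ‖a'‖ ≤ 1 ∧ a = (‖a‖ : ℂ) • a' := by
  rcases eq_or_ne a 0 with rfl | ha
  · exact ⟨0, by simp⟩
  · have h : (‖a‖ : ℂ) ≠ 0 := by simpa using ha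
    refine ⟨(‖a‖ : ℂ)⁻¹ • a, ?_, by rw [smul_inv_smul₀ h]⟩
    rw [norm_smul, norm_inv, Complex.norm_real, norm_norm, inv_mul_cancel₀ (by simpa using ha)]

theorem norm_le_of_forall_unit_product {E : Type*} [NormedAddCommGroup E] [NormedSpace ℂ E]
    {f : Bipartite H₁ H₂ →ₗ[ℂ] E} {c : ℝ}
    (h : ∀ a b, ‖a‖ ≤ 1 → ‖b‖ ≤ 1 → ‖f (tmulL H₁ H₂ a b)‖ ≤ c) (a : H₁) (b : H₂) :
    ‖f (tmulL H₁ H₂ a b)‖ ≤ c * (‖a‖ * ‖b‖) := by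
  obtain ⟨a', ha', ha⟩ := exists_norm_le_one_smul a
  obtain ⟨b', hb', hb⟩ := exists_norm_le_one_smul b
  have : f (tmulL H₁ H₂ a b) = ((‖a‖ : ℂ) * (‖b‖ : ℂ)) • f (tmulL H₁ H₂ a' b') := by
    conv_lhs => rw [ha, hb]
    simp only [map_smul, smul_apply, mul_smul]
    exact smul_comm _ _ _
  rw [this, norm_smul, norm_mul, Complex.norm_real, Complex.norm_real, norm_norm, norm_norm,
    mul_comm c]
  exact mul_le_mul_of_nonneg_left (h a' b' ha' hb') (by positivity)

/-- The images of the product vectors of norm at most one span the range of a surjective bounded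
operator onto a finite-dimensional space. -/
theorem span_image_unit_products {V : Type*} [NormedAddCommGroup V] [NormedSpace ℂ V]
    [FiniteDimensional ℂ V] (Φ : Bipartite H₁ H₂ →L[ℂ] V) (hΦ : Function.Surjective Φ) :
    Submodule.span ℂ {y : V | ∃ a b, ‖a‖ ≤ 1 ∧ ‖b‖ ≤ 1 ∧ Φ (tmulL H₁ H₂ a b) = y} = ⊤ := by
  set F := {y : V | ∃ a b, ‖a‖ ≤ 1 ∧ ‖b‖ ≤ 1 ∧ Φ (tmulL H₁ H₂ a b) = y}
  set G : Submodule ℂ (Bipartite H₁ H₂) := (Submodule.span ℂ F).comap (Φ : _ →ₗ[ℂ] V) with hG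
  have hclosed : IsClosed (G : Set (Bipartite H₁ H₂)) :=
    (Submodule.closed_of_finiteDimensional (Submodule.span ℂ F)).preimage Φ.continuous
  have hle : Submodule.span ℂ {t : Bipartite H₁ H₂ | ∃ a b, tmulL H₁ H₂ a b = t} ≤ G := by
    rw [Submodule.span_le]
    rintro _ ⟨a, b, rfl⟩
    obtain ⟨a', ha', ha⟩ := exists_norm_le_one_smul a
    obtain ⟨b', hb', hb⟩ := exists_norm_le_one_smul b
    rw [ha, hb]
    simp only [map_smul, smul_apply]
    exact G.smul_mem _ (G.smul_mem _ (Submodule.subset_span ⟨a', b', ha', hb', rfl⟩))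
  have htop : ∀ x, x ∈ G := fun x => by
    have : Dense (G : Set (Bipartite H₁ H₂)) := dense_span_tmulL.mono hle
    have h2 := hclosed.closure_eq ▸ this x
    exact h2
  refine Submodule.eq_top_iff'.2 fun y => ?_
  obtain ⟨x, rfl⟩ := hΦ y
  exact htop x

theorem IsAGSP.norm_le {σ : ℝ} {r : ℕ} {Y : Submodule ℂ (Bipartite H₁ H₂)}
    {K : Bipartite H₁ H₂ →L[ℂ] Bipartite H₁ H₂} (hK : IsAGSP σ r Y K) :
    ∀ φ ∈ Yᗮ, ‖K φ‖ ≤ σ * ‖φ‖ := by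
  intro φ hφ
  rcases eq_or_ne φ 0 with rfl | h0
  · simp
  have h1 : ‖φ‖ ≠ 0 := by simpa using h0
  have h2 := hK.shrinks ((‖φ‖ : ℂ)⁻¹ • φ) (Yᗮ.smul_mem _ hφ)
    (by rw [norm_smul, norm_inv, Complex.norm_real, norm_norm, inv_mul_cancel₀ h1])
  rw [map_smul, norm_smul, norm_inv, Complex.norm_real, norm_norm,
    inv_mul_le_iff₀ (by positivity)] at h2
  linarith

/-- If the powers of an operator of bounded Schmidt rank shrink fast enough, the target space has
a linear approximate lift to vectors of bounded Schmidt rank. -/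
theorem IsAGSP.exists_lift {σ : ℝ} {r : ℕ} {Y : Submodule ℂ (Bipartite H₁ H₂)}
    [FiniteDimensional ℂ Y] {K : Bipartite H₁ H₂ →L[ℂ] Bipartite H₁ H₂} (hK : IsAGSP σ r Y K)
    (hσ0 : 0 ≤ σ) (hσ : σ ≤ 1 / 2) {m : ℕ}
    (hm : 96 * Module.finrank ℂ Y * √((Module.finrank ℂ Y * r ^ m : ℕ) : ℝ) * σ ^ m ≤ 1) :
    ∃ U : Y →ₗ[ℂ] Bipartite H₁ H₂, ∀ y, ‖U y - y‖ ≤ ‖y‖ / 8 ∧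
      HasSchmidtRank (Module.finrank ℂ Y * r ^ m) (U y) := by
  obtain ⟨Φ, hΦ1, hΦK, hΦ3⟩ := exists_invariant_projection Y hσ0 hσ hK.fixes hK.norm_le
  have hΦm : ∀ x (m : ℕ), Φ ((K ^ m) x) = Φ x := fun x m => by
    induction m with
    | zero => simp
    | succ m ih => rw [pow_succ', mul_apply_eq_comp, hΦK, ih]
  set d := Module.finrank ℂ Y with hd
  obtain ⟨p, hpF, hp2⟩ := exists_basis_mem_norm_repr_le_two
    (span_image_unit_products Φ fun y => ⟨y, hΦ1 y⟩) (by
      refine (Metric.isBounded_closedBall (x := (0 : Y)) (r := ‖Φ‖)).subset ?_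
      rintro _ ⟨a, b, ha, hb, rfl⟩
      rw [mem_closedBall_zero_iff]
      refine (Φ.le_opNorm _).trans (mul_le_of_le_one_right (norm_nonneg _) ?_)
      rw [norm_tmulL]
      exact mul_le_one₀ ha (norm_nonneg _) hb)
  choose a b ha hb hab using hpF
  let c : Y →L[ℂ] (Fin d → ℂ) := LinearMap.toContinuousLinearMap (p.equivFun : Y →ₗ[ℂ] (Fin d → ℂ))
  have hc : ∀ y i, c y i = p.repr y i := fun y i => rfl
  -- A right inverse of `Φ` with values of rank at most `d`. It may be far from the inclusion; `K ^
  -- m` repairs this without changing the image under `Φ`.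
  let V : Y →ₗ[ℂ] Bipartite H₁ H₂ :=
    ∑ i, ((LinearMap.proj i).comp (c : Y →ₗ[ℂ] (Fin d → ℂ))).smulRight (tmulL H₁ H₂ (a i) (b i))
  have hV : ∀ y, V y = ∑ i, c y i • tmulL H₁ H₂ (a i) (b i) := fun y => by simp [V]
  have hΦV : ∀ y, Φ (V y) = y := fun y => by
    rw [hV, map_sum]
    simp only [map_smul, hab, hc]
    exact p.sum_repr y
  set A := ‖c‖ with hA
  have hA0 : 0 ≤ A := norm_nonneg c
  have hVn : ∀ y, ‖V y‖ ≤ d * A * ‖y‖ := fun y => by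
    rw [hV]
    calc _ ≤ ∑ i : Fin d, A * ‖y‖ := by
          refine norm_sum_le_of_le _ fun i _ => ?_
          rw [norm_smul, norm_tmulL]
          calc _ ≤ ‖c y‖ * 1 := by
                gcongr
                · exact norm_le_pi_norm (c y) i
                · exact mul_le_one₀ (ha i) (norm_nonneg _) (hb i)
            _ ≤ A * ‖y‖ := by rw [mul_one]; exact c.le_opNorm y
      _ = _ := by simp [mul_assoc]
  have hVr : ∀ y, HasSchmidtRank d (V y) := fun y =>
    ⟨Fin d, inferInstance, fun i => c y i • a i, b, by simp, by simp [hV]⟩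
  set S := d * r ^ m with hS
  set ε := 3 * σ ^ m * (d * A) with hε
  have hclose : ∀ y : Y, ‖(K ^ m) (V y) - y‖ ≤ ε * ‖y‖ := fun y => by
    have h := hΦ3 m (V y)
    rw [hΦV] at h
    refine h.trans ?_
    calc _ ≤ 3 * σ ^ m * (d * A * ‖y‖) := by gcongr; exact hVn y
      _ = _ := by rw [hε]; ring
  have hcoef : ∀ i (x : H₁) (y : H₂), ‖p.repr (Φ (tmulL H₁ H₂ x y)) i‖ ≤ 2 * (‖x‖ * ‖y‖) :=
    fun i => norm_le_of_forall_unit_product (f := (p.coord i).comp (Φ : _ →ₗ[ℂ] Y))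
      fun a b ha hb => hp2 _ ⟨a, b, ha, hb, rfl⟩ i
  have hε0 : 0 ≤ ε := by positivity
  -- Self-consistent bound: the coordinates of `z` are those of `Φ (K ^ m (V z))`, and `K ^ m (V z)`
  -- has rank at most `S`, hence splits into products of total norm at most `√S * ‖K ^ m (V z)‖`.
  -- Each product contributes at most twice its norm.
  have hA1 : A ≤ 2 * √(S : ℝ) * (1 + ε) := by
    refine c.opNorm_le_bound (by positivity) fun z => ?_
    refine (pi_norm_le_iff_of_nonneg (by positivity)).2 fun i => ?_
    obtain ⟨s, e, y, hu, hn⟩ := (hK.hasSchmidtRank_pow (hVr z) m).exists_sum_norm_le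
    have hz : z = ∑ k, Φ (tmulL H₁ H₂ (e k) (y k)) := by
      rw [← map_sum, ← hu, hΦm, hΦV]
    have hun : ‖(K ^ m) (V z)‖ ≤ (1 + ε) * ‖z‖ := by
      have h1 := norm_le_norm_add_norm_sub' ((K ^ m) (V z)) (z : Bipartite H₁ H₂)
      have h2 := hclose z
      have h3 : ‖(z : Bipartite H₁ H₂)‖ = ‖z‖ := rfl
      linarith
    calc ‖c z i‖ = ‖∑ k, p.repr (Φ (tmulL H₁ H₂ (e k) (y k))) i‖ := by
          rw [hc]; conv_lhs => rw [hz]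
          simp
      _ ≤ ∑ k, 2 * (‖e k‖ * ‖y k‖) := norm_sum_le_of_le _ fun k _ => hcoef i _ _
      _ ≤ 2 * (√(S : ℝ) * ((1 + ε) * ‖z‖)) := by
          rw [← Finset.mul_sum]
          have := hn.trans (mul_le_mul_of_nonneg_left hun (Real.sqrt_nonneg _))
          linarith
      _ = _ := by ring
  have hε1 : ε ≤ 1 / 8 := by
    set q := √(S : ℝ)
    have hq : 0 ≤ q := Real.sqrt_nonneg _
    have h0 : 0 ≤ (d : ℝ) * σ ^ m := by positivity
    -- As `ε` is proportional to `A`, the smallness of `σ ^ m` lets the `ε` term be absorbed on the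
    -- left, so `A ≤ 4 * q`.
    have h1 : 2 * q * ε ≤ A / 16 := by
      have : 2 * q * ε = (96 * d * q * σ ^ m) * A / 16 := by rw [hε]; ring
      rw [this]
      nlinarith
    have h2 : A ≤ 4 * q := by linarith
    calc ε = 3 * (d * σ ^ m) * A := by rw [hε]; ring
      _ ≤ 3 * (d * σ ^ m) * (4 * q) := by gcongr
      _ ≤ 1 / 8 := by linarith
  refine ⟨((K ^ m : Bipartite H₁ H₂ →L[ℂ] Bipartite H₁ H₂) : _ →ₗ[ℂ] _).comp V, fun y => ⟨?_, ?_⟩⟩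
  · refine (hclose y).trans ?_
    have := mul_le_mul_of_nonneg_right hε1 (norm_nonneg y)
    linarith
  · exact hK.hasSchmidtRank_pow (hVr y) m

end Lift

/-! ### Closeness of subspaces -/

section Viable

variable {E : Type u} [NormedAddCommGroup E] [InnerProductSpace ℂ E] [CompleteSpace E]

theorem IsViable.norm_sq_le {δ : ℝ} {Y Z : Submodule ℂ E} (h : IsViable δ Y Z) {z : E}
    (hz : z ∈ Z) : ‖Yᗮ.starProjection z‖ ^ 2 ≤ δ * ‖z‖ ^ 2 := by
  rcases eq_or_ne z 0 with rfl | h0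
  · simp
  have h1 : ‖z‖ ≠ 0 := by simpa using h0
  have h2 := h ((‖z‖ : ℂ)⁻¹ • z) (Z.smul_mem _ hz)
    (by rw [norm_smul, norm_inv, Complex.norm_real, norm_norm, inv_mul_cancel₀ h1])
  rw [← Submodule.inner_starProjection_left_eq_right, ← RCLike.re_eq_complex_re,
    Submodule.re_inner_starProjection_eq_normSq] at h2
  rw [map_smul, norm_smul, norm_inv, Complex.norm_real, norm_norm, mul_pow, inv_pow,
      inv_mul_le_iff₀ (by positivity), mul_comm] at h2
  exact h2

theorem IsViable.norm_le {δ c : ℝ} {Y Z : Submodule ℂ E} (h : IsViable δ Y Z) (hc : 0 ≤ c)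
    (hδ : δ ≤ c ^ 2) {z : E} (hz : z ∈ Z) : ‖Yᗮ.starProjection z‖ ≤ c * ‖z‖ := by
  refine le_of_sq_le_sq ?_ (by positivity)
  rw [mul_pow]
  exact (h.norm_sq_le hz).trans (by gcongr)

/-- A space for which a finite-dimensional space is viable has at most its dimension. -/
theorem IsViable.finiteDimensional {δ : ℝ} {Y Z : Submodule ℂ E} [FiniteDimensional ℂ Z]
    (h : IsViable δ Z Y) (hδ : δ < 1) :
    FiniteDimensional ℂ Y ∧ Module.finrank ℂ Y ≤ Module.finrank ℂ Z := by
  let f : Y →ₗ[ℂ] Z := (Z.orthogonalProjectionOnto : E →ₗ[ℂ] Z).comp Y.subtype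
  have hf : Function.Injective f := by
    rw [injective_iff_map_eq_zero]
    intro y hy
    have h1 : Z.starProjection (y : E) = 0 := congrArg Subtype.val hy
    have h2 := Z.starProjection_add_starProjection_orthogonal (y : E)
    rw [h1, zero_add] at h2
    have h3 := h.norm_sq_le y.2
    rw [h2] at h3
    have h4 : ‖(y : E)‖ ^ 2 = 0 := by nlinarith [sq_nonneg ‖(y : E)‖]
    simpa using h4
  exact ⟨FiniteDimensional.of_injective f hf, LinearMap.finrank_le_finrank_of_injective hf⟩

end Viable

/-! ### Passing from one target space to another -/

section Transfer

variable {H₁ : Type u} {H₂ : Type v}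
  [NormedAddCommGroup H₁] [InnerProductSpace ℂ H₁]
  [NormedAddCommGroup H₂] [InnerProductSpace ℂ H₂]

/-- A low Schmidt rank approximate lift of `Y` can be used to approximate the vectors of a space
`Z` close to `Y` by means of an AGSP for another space `W` close to `Z`. -/
theorem exists_approx_of_lift {Y W Z : Submodule ℂ (Bipartite H₁ H₂)} [FiniteDimensional ℂ Y]
    [FiniteDimensional ℂ W] [FiniteDimensional ℂ Z] {S r : ℕ} {U : Y →ₗ[ℂ] Bipartite H₁ H₂}
    (hU : ∀ y, ‖U y - y‖ ≤ ‖y‖ / 8 ∧ HasSchmidtRank S (U y)) {δ δ' σ : ℝ}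
    (hYZ : IsViable δ' Y Z) (hWZ : ApproxEq δ W Z) (hδ' : δ' ≤ 1 / 64) (hδ : δ ≤ 1 / 64)
    {K : Bipartite H₁ H₂ →L[ℂ] Bipartite H₁ H₂} (hK : IsAGSP σ r W K) (hσ : 0 ≤ σ)
    {ψ : Bipartite H₁ H₂} (hψ : ψ ∈ Z) (hψ1 : ‖ψ‖ = 1) :
    ∃ u, HasSchmidtRank (S * r) u ∧ ‖ψ - u‖ ^ 2 ≤ 2 * δ + 18 * σ ^ 2 := by
  let PY : Bipartite H₁ H₂ →L[ℂ] Y := Y.orthogonalProjectionOnto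
  let PW : Bipartite H₁ H₂ →L[ℂ] W := W.orthogonalProjectionOnto
  have hPYn : ∀ x, ‖PY x‖ ≤ ‖x‖ := fun x => Y.norm_starProjection_apply_le x
  have hUn : ∀ y : Y, ‖U y‖ ≤ 9 / 8 * ‖y‖ := fun y => by
    have h1 := norm_le_norm_add_norm_sub' (U y) (y : Bipartite H₁ H₂)
    have h2 := (hU y).1
    have h3 : ‖(y : Bipartite H₁ H₂)‖ = ‖y‖ := rfl
    linarith
  have hclose : ∀ w ∈ W, ‖w - U (PY w)‖ ≤ ‖w‖ / 2 := fun w hw => by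
    have h1 : ‖w - (PY w : Bipartite H₁ H₂)‖ ≤ ‖w‖ / 4 := by
      have e : w - (PY w : Bipartite H₁ H₂) = Yᗮ.starProjection w := by
        rw [sub_eq_iff_eq_add']
        exact (Y.starProjection_add_starProjection_orthogonal w).symm
      rw [e]
      -- `W` is compared with `Y` through `Z`; each of the two passages costs `√(1 / 64) = 1 / 8`.
      conv_lhs => rw [← Z.starProjection_add_starProjection_orthogonal w, map_add]
      have h2 := hYZ.norm_le (c := 1 / 8) (by norm_num) (by linarith)
        (Z.starProjection_apply_mem w)
      have h3 := Z.norm_starProjection_apply_le w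
      have h4 := hWZ.2.norm_le (c := 1 / 8) (by norm_num) (by linarith) hw
      have h5 := Yᗮ.norm_starProjection_apply_le (Zᗮ.starProjection w)
      refine (norm_add_le _ _).trans ?_
      linarith
    have h2 := (hU (PY w)).1
    have h3 := hPYn w
    have h4 := norm_sub_le_norm_sub_add_norm_sub w (PY w : Bipartite H₁ H₂) (U (PY w))
    rw [norm_sub_rev] at h2
    calc _ ≤ _ := h4
      _ ≤ ‖w‖ / 4 + ‖w‖ / 8 := add_le_add h1 (h2.trans (by gcongr))
      _ ≤ ‖w‖ / 2 := by linarith [norm_nonneg w]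
  -- `B` is within `1 / 2` of the identity, hence bijective, so the projection of `ψ` can be hit
  -- exactly by the projection of a low-rank vector.
  let B : W →ₗ[ℂ] W := (PW : _ →ₗ[ℂ] W).comp (U.comp ((PY : _ →ₗ[ℂ] Y).comp W.subtype))
  have hB : ∀ w : W, ‖w - B w‖ ≤ ‖w‖ / 2 := fun w => by
    have e : w - B w = PW ((w : Bipartite H₁ H₂) - U (PY w)) := by
      rw [map_sub]
      congr 1
      exact (W.orthogonalProjectionOnto_mem_subspace_eq_self w).symm
    rw [e]
    exact (W.norm_starProjection_apply_le _).trans (hclose w w.2)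
  have hBinj : Function.Injective B := by
    rw [injective_iff_map_eq_zero]
    intro w hw
    have := hB w
    rw [hw, sub_zero] at this
    have h0 := norm_nonneg w
    exact norm_eq_zero.1 (by linarith)
  obtain ⟨w, hw⟩ := LinearMap.injective_iff_surjective.1 hBinj (PW ψ)
  have hPWψ : ‖PW ψ‖ ≤ 1 := hψ1 ▸ W.norm_starProjection_apply_le ψ
  have hw2 : ‖w‖ ≤ 2 := by
    have h1 := norm_le_norm_add_norm_sub' w (B w)
    have h2 := hB w
    rw [hw] at h1 h2
    linarith
  set v := U (PY w) with hv
  have hPv : W.starProjection v = W.starProjection ψ := congrArg Subtype.val hw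
  have hvn : ‖v‖ ≤ 3 := by
    have h1 := hUn (PY w)
    have h2 : ‖PY w‖ ≤ ‖w‖ := hPYn w
    linarith
  refine ⟨K v, hK.hasSchmidtRank (hU _).2, ?_⟩
  set φ := Wᗮ.starProjection v with hφ
  have hKφ : ‖K φ‖ ≤ σ * 3 := by
    have h1 : ‖φ‖ ≤ 3 := (Wᗮ.norm_starProjection_apply_le v).trans hvn
    refine le_trans ?_ (mul_le_mul_of_nonneg_left h1 hσ)
    exact hK.norm_le φ (Wᗮ.starProjection_apply_mem v)
  have e : ψ - K v = Wᗮ.starProjection ψ - K φ := by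
    have h1 : K v = W.starProjection ψ + K φ := by
      conv_lhs => rw [← W.starProjection_add_starProjection_orthogonal v, map_add,
        hK.fixes _ (W.starProjection_apply_mem v), hPv]
    rw [h1]
    rw [sub_add_eq_sub_sub, ← sub_eq_iff_eq_add'.2
      (W.starProjection_add_starProjection_orthogonal ψ).symm]
  rw [e]
  have h1 := hWZ.1.norm_sq_le hψ
  rw [hψ1, one_pow, mul_one] at h1
  have h2 := norm_sub_le (Wᗮ.starProjection ψ) (K φ)
  have h3 : ‖Wᗮ.starProjection ψ - K φ‖ ^ 2 ≤ (‖Wᗮ.starProjection ψ‖ + ‖K φ‖) ^ 2 := by gcongr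
  have h4 : ‖K φ‖ ^ 2 ≤ (σ * 3) ^ 2 := by gcongr
  nlinarith [sq_nonneg (‖Wᗮ.starProjection ψ‖ - ‖K φ‖)]

end Transfer

end Bipartite

/-! ### Tails and entropy of decreasing sequences -/

section Scalar

/-- Truncated weights of total mass at most `S` on a decreasing sequence leave at least the tail. -/
theorem sum_tail_le_sum_one_sub_mul {N S : ℕ} {lam t : ℕ → ℝ} (hlam : AntitoneOn lam (Set.Iio N))
    (h0 : ∀ i < N, 0 ≤ lam i) (ht0 : ∀ i < N, 0 ≤ t i) (ht1 : ∀ i < N, t i ≤ 1)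
    (hS : ∑ i ∈ Finset.range N, t i ≤ S) :
    ∑ i ∈ Finset.range N with S ≤ i, lam i ≤ ∑ i ∈ Finset.range N, lam i * (1 - t i) := by
  rcases le_or_gt N S with hNS | hNS
  · rw [Finset.filter_false_of_mem (by intro i hi; simp at hi; omega), Finset.sum_empty]
    refine Finset.sum_nonneg fun i hi => ?_
    rw [Finset.mem_range] at hi
    exact mul_nonneg (h0 i hi) (by linarith [ht1 i hi])
  -- `lam S` serves as the exchange price: weight moved from indices below `S` to indices from `S`
  -- on does not increase the weighted sum.
  set c := lam S with hc
  have key : ∀ i ∈ Finset.range N,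
      c * ((if S ≤ i then 0 else 1) - t i) ≤
        lam i * (1 - t i) - (if S ≤ i then lam i else 0) := by
    intro i hi
    rw [Finset.mem_range] at hi
    split_ifs with h
    · have := hlam (show S ∈ Set.Iio N from hNS) (show i ∈ Set.Iio N from hi) h
      nlinarith [ht0 i hi]
    · have := hlam (show i ∈ Set.Iio N from hi) (show S ∈ Set.Iio N from hNS) (by omega)
      nlinarith [ht1 i hi]
  have h1 := Finset.sum_le_sum key
  rw [← Finset.mul_sum, Finset.sum_sub_distrib, Finset.sum_sub_distrib] at h1
  have h2 : ∑ i ∈ Finset.range N, (if S ≤ i then (0 : ℝ) else 1) = S := by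
    have : ∀ i, (if S ≤ i then (0 : ℝ) else 1) = if i < S then 1 else 0 := fun i => by
      split_ifs <;> first | rfl | omega
    simp only [this, ← Finset.sum_filter]
    rw [Finset.sum_const, nsmul_eq_mul, mul_one]
    congr 1
    have : (Finset.range N).filter (· < S) = Finset.range S := by
      ext i; simp; omega
    rw [this, Finset.card_range]
  rw [h2] at h1
  rw [Finset.sum_filter]
  have h3 : 0 ≤ c * (S - ∑ i ∈ Finset.range N, t i) :=
    mul_nonneg (h0 S hNS) (by linarith)
  linarith

theorem sum_range_inv_sq_le_two (N : ℕ) :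
    ∑ i ∈ Finset.range N, (((i : ℝ) + 1) ^ 2)⁻¹ ≤ 2 := by
  rcases N with _ | N
  · simp
  suffices h : ∑ i ∈ Finset.range (N + 1), (((i : ℝ) + 1) ^ 2)⁻¹ ≤ 2 - 1 / ((N : ℝ) + 1) by
    have : 0 ≤ 1 / ((N : ℝ) + 1) := by positivity
    linarith
  induction N with
  | zero => norm_num
  | succ n ih =>
    rw [Finset.sum_range_succ]
    have h : ((((n + 1 : ℕ) : ℝ) + 1) ^ 2)⁻¹ ≤
        1 / ((n : ℝ) + 1) - 1 / (((n + 1 : ℕ) : ℝ) + 1) := by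
      push_cast
      rw [div_sub_div _ _ (by positivity) (by positivity), ← one_div,
        div_le_div_iff₀ (by positivity) (by positivity)]
      nlinarith [(Nat.cast_nonneg n : (0 : ℝ) ≤ n)]
    linarith

/-- Gibbs' inequality for a single term. -/
theorem negMulLog_le_of_pos {x q : ℝ} (hx : 0 ≤ x) (hq : 0 < q) :
    Real.negMulLog x ≤ -(x * Real.log q) + q - x := by
  rcases hx.eq_or_lt with rfl | hx
  · simp [hq.le]
  have h := Real.log_le_sub_one_of_pos (div_pos hq hx)
  rw [Real.log_div hq.ne' hx.ne'] at h
  have h2 := mul_le_mul_of_nonneg_left h hx.le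
  have h3 : x * (q / x - 1) = q - x := by field_simp
  rw [Real.negMulLog]
  linarith

/-- Gibbs' inequality against the summable weights `(i + 1)⁻²`, whose logarithm yields the factor
two and whose sum is at most the additive two. -/
theorem sum_negMulLog_le {N : ℕ} {lam : ℕ → ℝ} (h0 : ∀ i < N, 0 ≤ lam i) :
    ∑ i ∈ Finset.range N, Real.negMulLog (lam i) ≤
      2 * ∑ i ∈ Finset.range N, lam i * Real.log (i + 1) + 2 := by
  have h : ∀ i ∈ Finset.range N, Real.negMulLog (lam i) ≤
      2 * (lam i * Real.log (i + 1)) + (((i : ℝ) + 1) ^ 2)⁻¹ := by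
    intro i hi
    have h1 := h0 i (Finset.mem_range.1 hi)
    have h2 := negMulLog_le_of_pos h1 (q := (((i : ℝ) + 1) ^ 2)⁻¹) (by positivity)
    rw [Real.log_inv, Real.log_pow] at h2
    push_cast at h2
    linarith
  refine (Finset.sum_le_sum h).trans ?_
  rw [Finset.sum_add_distrib, ← Finset.mul_sum]
  linarith [sum_range_inv_sq_le_two N]

/-- The logarithm of an index counts the thresholds `S₀ R ^ n` which the index exceeds. -/
theorem log_succ_le {S₀ R N i : ℕ} (hS : 1 ≤ S₀) (hR : 2 ≤ R) (hi : i < N) :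
    Real.log (i + 1) ≤ Real.log S₀ +
      Real.log R * ∑ n ∈ Finset.range N, (if S₀ * R ^ n ≤ i then (1 : ℝ) else 0) := by
  have hex : ∃ k, i < S₀ * R ^ k :=
    ⟨i, lt_of_lt_of_le (Nat.lt_pow_self (by omega)) (Nat.le_mul_of_pos_left _ hS)⟩
  classical
  set k := Nat.find hex with hk
  have hki : i < S₀ * R ^ k := Nat.find_spec hex
  have hkN : k ≤ N := (Nat.find_min' hex (lt_of_lt_of_le (Nat.lt_pow_self (by omega))
    (Nat.le_mul_of_pos_left _ hS))).trans hi.le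
  have h1 : (k : ℝ) ≤ ∑ n ∈ Finset.range N, (if S₀ * R ^ n ≤ i then (1 : ℝ) else 0) := by
    calc (k : ℝ) = ∑ n ∈ Finset.range k, (if S₀ * R ^ n ≤ i then (1 : ℝ) else 0) := by
          rw [Finset.sum_congr rfl fun n hn => if_pos (not_lt.1
            (Nat.find_min hex (Finset.mem_range.1 hn)))]
          simpa using hk
      _ ≤ _ := Finset.sum_le_sum_of_subset_of_nonneg (by simpa using hkN)
          fun n _ _ => by split_ifs <;> norm_num
  have hR0 : (0 : ℝ) < R := by exact_mod_cast (by omega : 0 < R)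
  have hS0 : (0 : ℝ) < S₀ := by exact_mod_cast hS
  have h2 : ((i : ℝ) + 1) ≤ S₀ * R ^ k := by exact_mod_cast hki
  have h3 := Real.log_le_log (by positivity) h2
  rw [Real.log_mul hS0.ne' (by positivity), Real.log_pow] at h3
  have h4 : 0 ≤ Real.log R := Real.log_nonneg (by exact_mod_cast (by omega : 1 ≤ R))
  nlinarith

/-- Bound for the mean logarithmic index of a subprobability sequence in terms of its tails. -/
theorem sum_mul_log_le {N S₀ R : ℕ} {lam : ℕ → ℝ} {T : ℝ} (hS : 1 ≤ S₀) (hR : 1 ≤ R)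
    (h0 : ∀ i < N, 0 ≤ lam i) (h1 : ∑ i ∈ Finset.range N, lam i ≤ 1)
    (hR1 : R = 1 → ∀ i < N, S₀ ≤ i → lam i = 0)
    (hT : ∑ n ∈ Finset.range N, ∑ i ∈ Finset.range N with S₀ * R ^ n ≤ i, lam i ≤ T) :
    ∑ i ∈ Finset.range N, lam i * Real.log (i + 1) ≤ Real.log S₀ + T * Real.log R := by
  have hS0 : (0 : ℝ) < S₀ := by exact_mod_cast hS
  have hlS : 0 ≤ Real.log S₀ := Real.log_nonneg (by exact_mod_cast hS)
  rcases hR.eq_or_lt with rfl | hR2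
  -- For `R = 1` the thresholds do not grow and counting them gives nothing; `hR1` confines the
  -- sequence to the indices below `S₀`.
  · have : ∀ i ∈ Finset.range N, lam i * Real.log (i + 1) ≤ lam i * Real.log S₀ := by
      intro i hi
      rw [Finset.mem_range] at hi
      rcases le_or_gt S₀ i with h | h
      · rw [hR1 rfl i hi h]; simp
      · refine mul_le_mul_of_nonneg_left (Real.log_le_log (by positivity) ?_) (h0 i hi)
        exact_mod_cast h
    refine (Finset.sum_le_sum this).trans ?_
    rw [← Finset.sum_mul]
    simp only [Nat.cast_one, Real.log_one, mul_zero, add_zero]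
    nlinarith
  · have hlR : 0 ≤ Real.log R := Real.log_nonneg (by exact_mod_cast hR)
    have : ∀ i ∈ Finset.range N, lam i * Real.log (i + 1) ≤ lam i * Real.log S₀ +
        Real.log R * ∑ n ∈ Finset.range N, (if S₀ * R ^ n ≤ i then lam i else 0) := by
      intro i hi
      rw [Finset.mem_range] at hi
      refine (mul_le_mul_of_nonneg_left (log_succ_le hS hR2 hi) (h0 i hi)).trans_eq ?_
      rw [mul_add, mul_left_comm, Finset.mul_sum]
      simp
    refine (Finset.sum_le_sum this).trans ?_
    rw [Finset.sum_add_distrib, ← Finset.sum_mul, ← Finset.mul_sum, Finset.sum_comm]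
    simp only [← Finset.sum_filter]
    nlinarith

end Scalar

namespace Bipartite

/-! ### Spectrum of the reduced density -/

section Spectral

theorem inner_self_eq_ofReal {E : Type*} [NormedAddCommGroup E] [InnerProductSpace ℂ E] (x : E) :
    ⟪x, x⟫_ℂ = ((‖x‖ ^ 2 : ℝ) : ℂ) := by
  rw [inner_self_eq_norm_sq_to_K]
  norm_cast

variable {H₁ : Type u} {H₂ : Type v}
  [NormedAddCommGroup H₁] [InnerProductSpace ℂ H₁] [CompleteSpace H₁]
  [NormedAddCommGroup H₂] [InnerProductSpace ℂ H₂] [CompleteSpace H₂]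

theorem inner_reducedDensity (ψ : Bipartite H₁ H₂) (x' x : H₁) :
    ⟪x', reducedDensity ψ x⟫_ℂ = ⟪sliceLeft ψ x, sliceLeft ψ x'⟫_ℂ := by
  rw [← inner_conj_symm x', ← inner_conj_symm (sliceLeft ψ x), inner_sliceLeft]
  simp only [reducedDensity, ContinuousLinearMap.comp_apply]
  rw [inner_sliceRight]

theorem isSymmetric_reducedDensity (ψ : Bipartite H₁ H₂) :
    (reducedDensity ψ).toLinearMap.IsSymmetric := by
  intro x y
  change ⟪reducedDensity ψ x, y⟫_ℂ = ⟪x, reducedDensity ψ y⟫_ℂ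
  rw [← inner_conj_symm, inner_reducedDensity, inner_reducedDensity, inner_conj_symm]

variable {ψ : Bipartite H₁ H₂}

theorem inner_tmulL_sliceLeft_of_eigen {e : H₁} {μ : ℝ}
    (he : reducedDensity ψ e = (μ : ℂ) • e) (x : H₁) :
    ⟪ψ, tmulL H₁ H₂ x (sliceLeft ψ e)⟫_ℂ = μ * ⟪e, x⟫_ℂ := by
  rw [← inner_sliceRight]
  change ⟪reducedDensity ψ e, x⟫_ℂ = _
  rw [he, inner_smul_left, Complex.conj_ofReal]

theorem inner_sliceLeft_sliceLeft_of_eigen {e : H₁} {μ : ℝ}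
    (he : reducedDensity ψ e = (μ : ℂ) • e) (x : H₁) :
    ⟪sliceLeft ψ x, sliceLeft ψ e⟫_ℂ = μ * ⟪e, x⟫_ℂ := by
  rw [inner_sliceLeft, inner_tmulL_sliceLeft_of_eigen he]

theorem eigenvalue_nonneg {e : H₁} {μ : ℝ} (he : reducedDensity ψ e = (μ : ℂ) • e)
    (h0 : e ≠ 0) : 0 ≤ μ := by
  have h := inner_sliceLeft_sliceLeft_of_eigen he e
  rw [inner_self_eq_ofReal, inner_self_eq_ofReal] at h
  have h' : ‖sliceLeft ψ e‖ ^ 2 = μ * ‖e‖ ^ 2 := by exact_mod_cast h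
  have : 0 < ‖e‖ ^ 2 := by positivity
  by_contra hneg
  push Not at hneg
  nlinarith [sq_nonneg ‖sliceLeft ψ e‖]

/-- The Eckart-Young bound: the eigenvalues of the reduced density beyond the `S` largest ones
add up to at most the squared distance to any vector of Schmidt rank `S`. -/
theorem sum_tail_eigenvalues_le {N : ℕ} {e : Fin N → H₁} {lam : ℕ → ℝ} (he : Orthonormal ℂ e)
    (hlam : AntitoneOn lam (Set.Iio N))
    (hev : ∀ i : Fin N, reducedDensity ψ (e i) = (lam i : ℂ) • e i)
    {S : ℕ} {u : Bipartite H₁ H₂} (hu : HasSchmidtRank S u) :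
    ∑ i ∈ Finset.range N with S ≤ i, lam i ≤ ‖ψ - u‖ ^ 2 := by
  obtain ⟨s, f, y, hs, hf, rfl⟩ := hu.exists_orthonormal
  let X : Submodule ℂ H₁ := Submodule.span ℂ (Set.range f)
  have : FiniteDimensional ℂ X := FiniteDimensional.span_of_finite ℂ (Set.finite_range f)
  set Q := Xᗮ.starProjection with hQ
  have hQf : ∀ k x, ⟪f k, Q x⟫_ℂ = 0 := fun k x =>
    (Xᗮ.starProjection_apply_mem x) (f k) (Submodule.subset_span ⟨k, rfl⟩)
  have hQQ : ∀ x, ⟪x, Q x⟫_ℂ = (‖Q x‖ ^ 2 : ℝ) := fun x => by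
    have h1 : Q x = Q (Q x) := (Submodule.starProjection_eq_self_iff.2
      (Xᗮ.starProjection_apply_mem x)).symm
    rw [h1, ← Submodule.inner_starProjection_left_eq_right, ← hQ, ← h1,
      inner_self_eq_ofReal]
  have hlam0 : ∀ i : Fin N, 0 ≤ lam i := fun i => eigenvalue_nonneg (hev i) (he.ne_zero i)
  set q : ℝ := ∑ i : Fin N, lam i * ‖Q (e i)‖ ^ 2 with hq
  have hq0 : 0 ≤ q := Finset.sum_nonneg fun i _ => mul_nonneg (hlam0 i) (by positivity)
  -- `g` is the part of `ψ` on the given eigenvectors with its left factors projected off those of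
  -- `u`. It is orthogonal to `u` and `⟪ψ, g⟫ = ‖g‖ ^ 2 = q`, so Cauchy-Schwarz gives `q ≤ ‖ψ - u‖ ^
  -- 2`.
  set g := ∑ i : Fin N, tmulL H₁ H₂ (Q (e i)) (sliceLeft ψ (e i)) with hg
  have hgu : ⟪∑ k, tmulL H₁ H₂ (f k) (y k), g⟫_ℂ = 0 := by
    rw [hg]
    simp [sum_inner, inner_sum, inner_tmulL, hQf]
  have hgψ : ⟪ψ, g⟫_ℂ = q := by
    rw [hg, inner_sum, hq]
    push_cast
    refine Finset.sum_congr rfl fun i _ => ?_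
    rw [inner_tmulL_sliceLeft_of_eigen (hev i), hQQ]
    push_cast
    rfl
  have hgg : ‖g‖ ^ 2 = q := by
    have h1 : ⟪g, g⟫_ℂ = q := by
      rw [hg, hq]
      simp only [sum_inner, inner_sum, inner_tmulL, inner_sliceLeft_sliceLeft_of_eigen (hev _),
        orthonormal_iff_ite.mp he]
      push_cast
      refine Finset.sum_congr rfl fun i _ => ?_
      rw [Finset.sum_eq_single i (fun j _ hj => by simp [hj.symm]) (by simp)]
      rw [inner_self_eq_norm_sq_to_K]
      simp [mul_comm]
    rw [inner_self_eq_ofReal] at h1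
    exact_mod_cast h1
  have hmain : q ≤ ‖ψ - ∑ k, tmulL H₁ H₂ (f k) (y k)‖ ^ 2 := by
    have h1 : ⟪ψ - ∑ k, tmulL H₁ H₂ (f k) (y k), g⟫_ℂ = q := by
      rw [inner_sub_left, hgu, hgψ, sub_zero]
    have h2 := norm_inner_le_norm (𝕜 := ℂ) (ψ - ∑ k, tmulL H₁ H₂ (f k) (y k)) g
    rw [h1, Complex.norm_real, Real.norm_of_nonneg hq0] at h2
    set n := ‖ψ - ∑ k, tmulL H₁ H₂ (f k) (y k)‖
    have h3 : q ^ 2 ≤ n ^ 2 * q := by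
      calc q ^ 2 ≤ (n * ‖g‖) ^ 2 := by gcongr
        _ = n ^ 2 * q := by rw [mul_pow, hgg]
    rcases hq0.eq_or_lt with h | h
    · rw [← h]; positivity
    · exact le_of_mul_le_mul_right (by linarith [sq q]) h
  refine le_trans ?_ hmain
  classical
  -- The weight of `e i` inside the left support `X` of `u`. These weights lie in `[0, 1]` and sum
  -- to at most `dim X ≤ S` by Bessel, so `q` dominates the tail.
  let t : ℕ → ℝ := fun i => if h : i < N then 1 - ‖Q (e ⟨i, h⟩)‖ ^ 2 else 0
  have ht : ∀ i : Fin N, t i = 1 - ‖Q (e i)‖ ^ 2 := fun i => by simp [t]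
  have hpyth : ∀ i : Fin N, 1 - ‖Q (e i)‖ ^ 2 = ‖X.starProjection (e i)‖ ^ 2 := fun i => by
    have := X.norm_sq_eq_add_norm_sq_starProjection (e i)
    rw [he.norm_eq_one] at this
    linarith
  have hbessel : ∑ i : Fin N, (1 - ‖Q (e i)‖ ^ 2) ≤ (S : ℝ) := by
    let b := stdOrthonormalBasis ℂ X
    have h1 : ∀ i, ‖X.starProjection (e i)‖ ^ 2 = ∑ k, ‖⟪e i, (b k : H₁)⟫_ℂ‖ ^ 2 := fun i => by
      have := b.sum_sq_norm_inner_right (X.orthogonalProjectionOnto (e i))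
      rw [show ‖X.starProjection (e i)‖ = ‖X.orthogonalProjectionOnto (e i)‖ from rfl, ← this]
      refine Finset.sum_congr rfl fun k _ => ?_
      rw [Submodule.coe_inner, ← norm_inner_symm]
      congr 2
      exact Submodule.inner_starProjection_left_eq_right X (e i) (b k) |>.trans (by
        rw [Submodule.starProjection_eq_self_iff.2 (b k).2])
    rw [Finset.sum_congr rfl fun i _ => (hpyth i).trans (h1 i), Finset.sum_comm]
    have h2 : ∀ k ∈ Finset.univ, ∑ i, ‖⟪e i, (b k : H₁)⟫_ℂ‖ ^ 2 ≤ 1 := fun k _ => by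
      refine (he.sum_inner_products_le _).trans ?_
      have : ‖(b k : H₁)‖ = 1 := b.orthonormal.norm_eq_one k
      rw [this, one_pow]
    refine (Finset.sum_le_sum h2).trans ?_
    simp only [Finset.sum_const, Finset.card_univ, Fintype.card_fin, nsmul_eq_mul, mul_one]
    have h3 : Module.finrank ℂ X ≤ s :=
      (finrank_range_le_card f).trans_eq (Fintype.card_fin s)
    exact_mod_cast h3.trans hs
  have hlem := sum_tail_le_sum_one_sub_mul (N := N) (S := S) (lam := lam) (t := t) hlam
    (fun i hi => hlam0 ⟨i, hi⟩)
    (fun i hi => by rw [ht ⟨i, hi⟩, hpyth]; positivity)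
    (fun i hi => by rw [ht ⟨i, hi⟩]; linarith [sq_nonneg ‖Q (e ⟨i, hi⟩)‖])
    (by rw [← Fin.sum_univ_eq_sum_range]; simpa only [ht] using hbessel)
  refine hlem.trans_eq ?_
  rw [← Fin.sum_univ_eq_sum_range (fun i => lam i * (1 - t i)), hq]
  refine Finset.sum_congr rfl fun i _ => ?_
  rw [ht]; ring

/-- A uniform bound on the entropy of finite decreasing families of eigenvalues of the reduced
density bounds the entanglement entropy. -/
theorem entanglementEntropy_le {B : ℝ}
    (h : ∀ (N : ℕ) (e : Fin N → H₁) (lam : ℕ → ℝ), Orthonormal ℂ e →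
      AntitoneOn lam (Set.Iio N) →
      (∀ i : Fin N, reducedDensity ψ (e i) = (lam i : ℂ) • e i) →
      ∑ i ∈ Finset.range N, Real.negMulLog (lam i) ≤ B)
    (h1 : ∀ (e : H₁) (μ : ℝ), ‖e‖ = 1 → reducedDensity ψ e = (μ : ℂ) • e → μ ≤ 1) :
    entanglementEntropy ψ ≤ ENNReal.ofReal B := by
  classical
  unfold entanglementEntropy
  refine ENNReal.summable.tsum_le_of_sum_le fun F => ?_
  set T := (reducedDensity ψ).toLinearMap
  let d : ℝ → ℕ := fun μ => Module.finrank ℂ (Module.End.eigenspace T (μ : ℂ))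
  -- `finrank` is also zero for infinite-dimensional eigenspaces. What remains is
  -- finite-dimensional, and the discarded terms vanish.
  set F' := F.filter (fun μ => d μ ≠ 0) with hF'
  have hfd : ∀ μ : F', FiniteDimensional ℂ (Module.End.eigenspace T ((μ : ℝ) : ℂ)) := fun μ =>
    Module.finite_of_finrank_pos (Nat.pos_of_ne_zero (Finset.mem_filter.1 μ.2).2)
  let ι := Σ μ : F', Fin (d μ)
  let e : ι → H₁ := fun a => (stdOrthonormalBasis ℂ (Module.End.eigenspace T ((a.1 : ℝ) : ℂ)) a.2 :)
  have he : Orthonormal ℂ e := by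
    have h1 := (isSymmetric_reducedDensity ψ).orthogonalFamily_eigenspaces.comp
      (γ := F') (f := fun μ => ((μ : ℝ) : ℂ))
      (Complex.ofReal_injective.comp Subtype.val_injective)
    exact h1.orthonormal_sigma_orthonormal
      (v_family := fun μ => stdOrthonormalBasis ℂ (Module.End.eigenspace T ((μ : ℝ) : ℂ)))
      fun μ => (stdOrthonormalBasis ℂ (Module.End.eigenspace T ((μ : ℝ) : ℂ))).orthonormal
  have hev : ∀ a : ι, reducedDensity ψ (e a) = ((a.1 : ℝ) : ℂ) • e a := fun a =>
    Module.End.mem_eigenspace_iff.1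
      (stdOrthonormalBasis ℂ (Module.End.eigenspace T ((a.1 : ℝ) : ℂ)) a.2).2
  set N := Fintype.card ι with hN
  let g : Fin N ≃ ι := (Fintype.equivFin ι).symm
  -- The sign turns increasing sorting into decreasing eigenvalues.
  let val : Fin N → ℝ := fun i => -((g i).1 : ℝ)
  let τ := (Tuple.sort val).trans g
  have hmono : Monotone (val ∘ Tuple.sort val) := Tuple.monotone_sort val
  let lam : ℕ → ℝ := fun i => if hi : i < N then ((τ ⟨i, hi⟩).1 : ℝ) else 0
  have hlam : ∀ i : Fin N, lam i = ((τ i).1 : ℝ) := fun i => by simp [lam]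
  have hB := h N (e ∘ τ) lam (he.comp τ τ.injective) (by
    intro i hi j hj hij
    have h2 := hmono (show (⟨i, hi⟩ : Fin N) ≤ ⟨j, hj⟩ from hij)
    rw [hlam ⟨i, hi⟩, hlam ⟨j, hj⟩]
    simpa [val, τ] using h2) (fun i => by rw [hlam]; exact hev _)
  have hsum : ∑ i ∈ Finset.range N, Real.negMulLog (lam i) =
      ∑ μ : F', (d μ : ℝ) * Real.negMulLog μ := by
    rw [← Fin.sum_univ_eq_sum_range (fun i => Real.negMulLog (lam i))]
    simp only [hlam]
    rw [τ.sum_comp (fun a => Real.negMulLog (a.1 : ℝ)), Fintype.sum_sigma]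
    simp
  rw [hsum] at hB
  have hnn : ∀ μ : F', 0 ≤ Real.negMulLog μ := fun μ => by
    let a : ι := ⟨μ, ⟨0, Nat.pos_of_ne_zero (Finset.mem_filter.1 μ.2).2⟩⟩
    exact Real.negMulLog_nonneg (eigenvalue_nonneg (hev a) (he.ne_zero a))
      (h1 _ _ (he.norm_eq_one a) (hev a))
  calc _ = ∑ μ ∈ F', (d μ : ENNReal) * ENNReal.ofReal (Real.negMulLog μ) := by
        rw [hF', Finset.sum_filter_of_ne]
        intro μ _ hne h0
        exact hne (by simp [h0])
    _ = ∑ μ : F', ENNReal.ofReal ((d μ : ℝ) * Real.negMulLog μ) := by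
        rw [← Finset.sum_coe_sort F']
        refine Finset.sum_congr rfl fun μ _ => ?_
        rw [ENNReal.ofReal_mul (by positivity), ENNReal.ofReal_natCast]
    _ = ENNReal.ofReal (∑ μ : F', (d μ : ℝ) * Real.negMulLog μ) :=
        (ENNReal.ofReal_sum_of_nonneg fun μ _ => mul_nonneg (by positivity) (hnn μ)).symm
    _ ≤ ENNReal.ofReal B := ENNReal.ofReal_le_ofReal hB

end Spectral

end Bipartite

namespace Bipartite

/-! ### Limits of product vectors -/

section ProductLimit

variable {H₁ : Type u} {H₂ : Type v}
  [NormedAddCommGroup H₁] [InnerProductSpace ℂ H₁]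
  [NormedAddCommGroup H₂] [InnerProductSpace ℂ H₂] {ψ : Bipartite H₁ H₂}

theorem HasSchmidtRank.minor_eq {u : Bipartite H₁ H₂} (hu : HasSchmidtRank 1 u) (a c : H₁)
    (b d : H₂) :
    ⟪u, tmulL H₁ H₂ a b⟫_ℂ * ⟪u, tmulL H₁ H₂ c d⟫_ℂ =
      ⟪u, tmulL H₁ H₂ a d⟫_ℂ * ⟪u, tmulL H₁ H₂ c b⟫_ℂ := by
  obtain ⟨ι, _, x, y, hc, rfl⟩ := hu
  have := Fintype.card_le_one_iff_subsingleton.1 hc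
  rcases isEmpty_or_nonempty ι with h | ⟨⟨k⟩⟩
  · simp
  · simp only [Fintype.sum_subsingleton _ k, inner_tmulL]
    ring

/-- The vanishing of the two-by-two minors is a closed condition, so it passes to limits without any
compactness of the product vectors. -/
theorem minor_eq_of_mem_closure (hψ : ψ ∈ closure {u | HasSchmidtRank 1 u}) (a c : H₁)
    (b d : H₂) :
    ⟪ψ, tmulL H₁ H₂ a b⟫_ℂ * ⟪ψ, tmulL H₁ H₂ c d⟫_ℂ =
      ⟪ψ, tmulL H₁ H₂ a d⟫_ℂ * ⟪ψ, tmulL H₁ H₂ c b⟫_ℂ := by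
  have hcl : IsClosed {u : Bipartite H₁ H₂ |
      ⟪u, tmulL H₁ H₂ a b⟫_ℂ * ⟪u, tmulL H₁ H₂ c d⟫_ℂ =
        ⟪u, tmulL H₁ H₂ a d⟫_ℂ * ⟪u, tmulL H₁ H₂ c b⟫_ℂ} :=
    isClosed_eq (by fun_prop) (by fun_prop)
  exact closure_minimal (fun u hu => HasSchmidtRank.minor_eq hu a c b d) hcl hψ

variable [CompleteSpace H₁] [CompleteSpace H₂]

/-- The reduced density of a limit of product vectors has no nonzero eigenvalue other than one. -/
theorem eigenvalue_eq_one_of_mem_closure (hψ : ψ ∈ closure {u | HasSchmidtRank 1 u})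
    (hψ1 : ‖ψ‖ = 1) {e : H₁} {μ : ℝ} (he : reducedDensity ψ e = (μ : ℂ) • e) (he1 : ‖e‖ = 1)
    (hμ : μ ≠ 0) : μ = 1 := by
  have hee : ⟪e, e⟫_ℂ = 1 := by rw [inner_self_eq_ofReal, he1]; simp
  -- The minors through `e` and `sliceLeft ψ e`, divided by `μ`, factor `ψ` as a product on all
  -- product vectors.
  have hψe : ψ = tmulL H₁ H₂ e (sliceLeft ψ e) := by
    rw [← sub_eq_zero]
    refine dense_span_tmulL.eq_zero_of_inner_left (𝕜 := ℂ) fun v hv => ?_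
    rw [SetLike.mem_coe] at hv
    induction hv using Submodule.span_induction with
    | mem x hx =>
      obtain ⟨a, b, rfl⟩ := hx
      have h := minor_eq_of_mem_closure hψ a e b (sliceLeft ψ e)
      rw [inner_tmulL_sliceLeft_of_eigen he, inner_tmulL_sliceLeft_of_eigen he, hee, mul_one,
        ← inner_sliceLeft ψ e b] at h
      have hμ' : (μ : ℂ) ≠ 0 := by exact_mod_cast hμ
      have h2 : ⟪ψ, tmulL H₁ H₂ a b⟫_ℂ = ⟪e, a⟫_ℂ * ⟪sliceLeft ψ e, b⟫_ℂ :=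
        mul_right_cancel₀ hμ' (by rw [h]; ring)
      rw [inner_sub_left, inner_tmulL, h2, sub_self]
    | zero => exact inner_zero_right _
    | add x y _ _ hx hy =>
      rw [inner_add_right, hx, hy, add_zero]
    | smul c x _ hx =>
      rw [inner_smul_right, hx, mul_zero]
  have h1 := inner_sliceLeft_sliceLeft_of_eigen he e
  rw [hee, mul_one, inner_self_eq_ofReal] at h1
  have h2 : ‖sliceLeft ψ e‖ ^ 2 = μ := by exact_mod_cast h1
  have h3 : ‖ψ‖ = ‖e‖ * ‖sliceLeft ψ e‖ := by
    conv_lhs => rw [hψe]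
    exact norm_tmulL _ _
  rw [hψ1, he1, one_mul] at h3
  rw [← h2, ← h3, one_pow]

end ProductLimit

/-! ### Entropy from low-rank approximations -/

section Entropy

variable {H₁ : Type u} {H₂ : Type v}
  [NormedAddCommGroup H₁] [InnerProductSpace ℂ H₁] [CompleteSpace H₁]
  [NormedAddCommGroup H₂] [InnerProductSpace ℂ H₂] [CompleteSpace H₂] {ψ : Bipartite H₁ H₂}

/-- The Eckart-Young bound for a single eigenvector and the zero vector, of Schmidt rank zero. -/
theorem eigenvalue_le_one (hψ1 : ‖ψ‖ = 1) {e : H₁} {μ : ℝ} (he1 : ‖e‖ = 1)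
    (he : reducedDensity ψ e = (μ : ℂ) • e) : μ ≤ 1 := by
  have h := sum_tail_eigenvalues_le (ψ := ψ) (N := 1) (e := fun _ => e) (lam := fun _ => μ)
    ⟨fun _ => he1, fun i j hij => (hij (Subsingleton.elim _ _)).elim⟩
    antitoneOn_const (fun _ => he) hasSchmidtRank_zero
  simpa [hψ1] using h

/-- A limit of product vectors has no entanglement entropy. -/
theorem entanglementEntropy_eq_zero_of_mem_closure
    (hψ : ψ ∈ closure {u | HasSchmidtRank 1 u}) (hψ1 : ‖ψ‖ = 1) :
    entanglementEntropy ψ = 0 := by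
  refine le_antisymm ((entanglementEntropy_le (B := 0) (fun N e lam he _ hev => ?_)
    fun e μ h h' => eigenvalue_le_one hψ1 h h').trans (by simp)) bot_le
  refine (Finset.sum_eq_zero fun i hi => ?_).le
  rw [Finset.mem_range] at hi
  by_cases h0 : lam i = 0
  · simp [h0]
  · simp [eigenvalue_eq_one_of_mem_closure hψ hψ1 (hev ⟨i, hi⟩) (he.norm_eq_one _) h0]

/-- The entropy of a unit vector approximated by vectors of Schmidt rank `S₀ R ^ n` up to
summable errors. -/
theorem entanglementEntropy_le_of_approx (hψ1 : ‖ψ‖ = 1) {S₀ R : ℕ} (hS : 1 ≤ S₀) (hR : 1 ≤ R)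
    {τ : ℕ → ℝ} {T : ℝ} (hτ : Filter.Tendsto τ Filter.atTop (nhds 0))
    (hT : ∀ N, ∑ n ∈ Finset.range N, τ n ≤ T)
    (happ : ∀ n, ∃ u, HasSchmidtRank (S₀ * R ^ n) u ∧ ‖ψ - u‖ ^ 2 ≤ τ n) :
    entanglementEntropy ψ ≤
      ENNReal.ofReal (2 * (Real.log S₀ + T * Real.log R) + 2) := by
  refine entanglementEntropy_le (fun N e lam he hlam hev => ?_)
    fun e μ h h' => eigenvalue_le_one hψ1 h h'
  have h0 : ∀ i < N, 0 ≤ lam i := fun i hi => eigenvalue_nonneg (hev ⟨i, hi⟩) (he.ne_zero _)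
  have htail : ∀ n, ∑ i ∈ Finset.range N with S₀ * R ^ n ≤ i, lam i ≤ τ n := fun n => by
    obtain ⟨u, hu, hn⟩ := happ n
    exact (sum_tail_eigenvalues_le he hlam hev hu).trans hn
  have hsum : ∑ i ∈ Finset.range N, lam i ≤ 1 := by
    have := sum_tail_eigenvalues_le he hlam hev hasSchmidtRank_zero
    simpa [hψ1] using this
  refine (sum_negMulLog_le h0).trans ?_
  have := sum_mul_log_le hS hR h0 hsum (fun hR1 i hi hSi => ?_)
    ((Finset.sum_le_sum fun n _ => htail n).trans (hT N))
  · linarith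
  -- For `R = 1` the rank stays `S₀` while the error tends to zero, so every eigenvalue beyond `S₀`
  -- vanishes.
  · refine le_antisymm (ge_of_tendsto' hτ fun n => ?_) (h0 i hi)
    refine le_trans ?_ (htail n)
    refine Finset.single_le_sum (f := lam) (fun j hj => h0 j ?_) ?_
    · exact Finset.mem_range.1 (Finset.mem_filter.1 hj).1
    · simp [hR1, hi, hSi]

end Entropy

/-! ### Choice of parameters and the final bound -/

section Main

variable {H₁ : Type u} {H₂ : Type v}
  [NormedAddCommGroup H₁] [InnerProductSpace ℂ H₁]
  [NormedAddCommGroup H₂] [InnerProductSpace ℂ H₂]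

/-- A power of polynomial size suffices for the contraction to beat the growth of the rank. -/
theorem exists_power (R D : ℕ) (hR : 1 ≤ R) (hD : 1 ≤ D) :
    ∃ m : ℕ, 9216 * (D : ℝ) ^ 3 ≤ (4 * R) ^ m ∧
      m * Real.log R ≤ 17 * Real.log R + 3 * Real.log D := by
  have hb : 1 < 4 * R := by omega
  have hD3 : 1 ≤ D ^ 3 := Nat.one_le_pow _ _ hD
  refine ⟨Nat.clog (4 * R) (9216 * D ^ 3), by exact_mod_cast Nat.le_pow_clog hb _, ?_⟩
  set m := Nat.clog (4 * R) (9216 * D ^ 3) with hm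
  have hm0 : 0 < m := Nat.clog_pos hb (by omega)
  -- Minimality of `m` bounds `R ^ (m - 1)` by `2 ^ 16 * D ^ 3`; for `R ≥ 2` the constant is
  -- absorbed as `16 * log 2 ≤ 16 * log R`.
  have h1 : (4 * R) ^ (m - 1) < 9216 * D ^ 3 := Nat.pow_pred_clog_lt_self hb (by omega)
  have hlD : 0 ≤ Real.log D := Real.log_nonneg (by exact_mod_cast hD)
  rcases hR.eq_or_lt with rfl | hR2
  · simpa using hlD
  have hR2' : (2 : ℝ) ≤ R := by exact_mod_cast hR2
  have hD' : (0 : ℝ) < D := by exact_mod_cast hD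
  have h2 : (R : ℝ) ^ m ≤ 2 ^ 16 * (R * D ^ 3) := by
    have h3 : R ^ (m - 1) ≤ (4 * R) ^ (m - 1) := Nat.pow_le_pow_left (by omega) _
    have h4 : R ^ m = R * R ^ (m - 1) := by
      rw [← pow_succ', Nat.sub_add_cancel hm0]
    have h5 : R ^ m ≤ 2 ^ 16 * (R * D ^ 3) := by
      rw [h4]
      calc R * R ^ (m - 1) ≤ R * (9216 * D ^ 3) := Nat.mul_le_mul_left _ (h3.trans h1.le)
        _ ≤ 2 ^ 16 * (R * D ^ 3) := by
          rw [Nat.mul_left_comm]; exact Nat.mul_le_mul_right _ (by norm_num)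
    exact_mod_cast h5
  have h3 := Real.log_le_log (by positivity) h2
  rw [Real.log_pow, Real.log_mul (by positivity) (by positivity), Real.log_pow,
    Real.log_mul (by positivity) (by positivity), Real.log_pow] at h3
  have h4 := Real.log_le_log (by norm_num) hR2'
  push_cast at h3
  linarith

/-- After squaring, `96 ^ 2 = 9216`, and each of the `n * m` factors `R` of the rank meets `1 / (2 *
R) ^ 2`, leaving `1 / (4 * R)`. -/
theorem lift_condition {R D d n m : ℕ} (hR : 1 ≤ R) (hd : d ≤ D) (hn : 1 ≤ n)
    (hm : 9216 * (D : ℝ) ^ 3 ≤ (4 * R) ^ m) :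
    96 * d * √((d * (R ^ n) ^ m : ℕ) : ℝ) * ((1 / (2 * (R : ℝ))) ^ n) ^ m ≤ 1 := by
  have hR' : (1 : ℝ) ≤ R := by exact_mod_cast hR
  have hd' : (d : ℝ) ≤ D := by exact_mod_cast hd
  refine le_of_sq_le_sq (b := 1) ?_ zero_le_one
  have h1 : (96 * d * √((d * (R ^ n) ^ m : ℕ) : ℝ) * ((1 / (2 * (R : ℝ))) ^ n) ^ m) ^ 2 =
      9216 * (d : ℝ) ^ 3 / ((4 * R) ^ m) ^ n := by
    rw [mul_pow, mul_pow, Real.sq_sqrt (by positivity)]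
    push_cast
    rw [eq_div_iff (by positivity)]
    have h2 : (((1 / (2 * (R : ℝ))) ^ n) ^ m) ^ 2 * ((4 * (R : ℝ)) ^ m) ^ n * ((R : ℝ) ^ n) ^ m
        = 1 := by
      simp only [← pow_mul]
      rw [mul_comm m n, mul_comm (n * m) 2, pow_mul, ← mul_pow, ← mul_pow]
      have : (1 / (2 * (R : ℝ))) ^ 2 * (4 * R) * R = 1 := by field_simp; norm_num
      rw [this, one_pow]
    calc _ = 9216 * (d : ℝ) ^ 3 * ((((1 / (2 * (R : ℝ))) ^ n) ^ m) ^ 2 *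
            ((4 * (R : ℝ)) ^ m) ^ n * ((R : ℝ) ^ n) ^ m) := by ring
      _ = _ := by rw [h2, mul_one]
  rw [h1, one_pow, div_le_one (by positivity)]
  have h4 : (1 : ℝ) ≤ (4 * R) ^ m := one_le_pow₀ (by linarith)
  calc 9216 * (d : ℝ) ^ 3 ≤ 9216 * (D : ℝ) ^ 3 := by gcongr
    _ ≤ (4 * (R : ℝ)) ^ m := hm
    _ ≤ ((4 * (R : ℝ)) ^ m) ^ n := le_self_pow₀ h4 (by omega)

theorem ApproxEq.nonneg {E : Type u} [NormedAddCommGroup E] [InnerProductSpace ℂ E]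
    [CompleteSpace E] {δ : ℝ} {Y Z : Submodule ℂ E} (h : ApproxEq δ Y Z) {ψ : E} (hψ : ψ ∈ Z)
    (hψ1 : ‖ψ‖ = 1) : 0 ≤ δ := by
  have := h.1.norm_sq_le hψ
  rw [hψ1, one_pow, mul_one] at this
  exact (sq_nonneg _).trans this

/-- Otherwise the first `⌊64 * M⌋₊ + 1` positive indices would each contribute more than `1 / 64`,
exceeding `M` in total. -/
theorem exists_small_index {δ : ℕ → ℝ} {M : ℝ}
    (hM : ∀ N, ∑ n ∈ Finset.range N, (n : ℝ) * δ n ≤ M) :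
    ∃ n, 1 ≤ n ∧ δ n ≤ 1 / 64 ∧ (n : ℝ) ≤ 64 * M + 1 := by
  have hM0 : 0 ≤ M := by simpa using hM 0
  set k := ⌊64 * M⌋₊ + 1 with hk
  have hk1 : (k : ℝ) ≤ 64 * M + 1 := by
    have := Nat.floor_le (a := 64 * M) (by positivity)
    rw [hk]; push_cast; linarith
  by_contra! hcon
  have h1 : ∀ i ∈ Finset.range k, 1 / 64 ≤ ((i + 1 : ℕ) : ℝ) * δ (i + 1) := by
    intro i hi
    have hik : ((i + 1 : ℕ) : ℝ) ≤ k := by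
      exact_mod_cast Finset.mem_range.1 hi
    have h2 : 1 / 64 < δ (i + 1) := by
      by_contra! h
      exact absurd (hcon (i + 1) (by omega) h) (by linarith)
    have h3 : (1 : ℝ) ≤ ((i + 1 : ℕ) : ℝ) := by exact_mod_cast (by omega : 1 ≤ i + 1)
    nlinarith
  have h2 := Finset.sum_le_sum h1
  have h3 := hM (k + 1)
  rw [Finset.sum_range_succ'] at h3
  simp only [Finset.sum_const, Finset.card_range, nsmul_eq_mul] at h2
  have h4 : 64 * M < k := by rw [hk]; push_cast; exact Nat.lt_floor_add_one _
  simp only [Nat.cast_zero, zero_mul, add_zero] at h3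
  linarith

/-- Low Schmidt rank approximations of the vectors of a space from AGSPs for nearby spaces. -/
theorem exists_approximations {Z : Submodule ℂ (Bipartite H₁ H₂)} [FiniteDimensional ℂ Z]
    {Z' : ℕ → Submodule ℂ (Bipartite H₁ H₂)} {δ : ℕ → ℝ} {R : ℕ}
    {K : ℕ → Bipartite H₁ H₂ →L[ℂ] Bipartite H₁ H₂} {M : ℝ} (hR : 1 ≤ R)
    (happ : ∀ n, ApproxEq (δ n) (Z' n) Z)
    (hM : ∀ N, ∑ n ∈ Finset.range N, (n : ℝ) * δ n ≤ M)
    (hK : ∀ n, 1 ≤ n → IsAGSP ((1 / (2 * (R : ℝ))) ^ n) (R ^ n) (Z' n) (K n))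
    {ψ : Bipartite H₁ H₂} (hψ : ψ ∈ Z) (hψ1 : ‖ψ‖ = 1) :
    ∃ S₀ : ℕ, 1 ≤ S₀ ∧ (R = 1 → S₀ = Module.finrank ℂ Z) ∧
      Real.log S₀ ≤ (17 * (64 * M + 1) + 1) *
        (Real.log R + Real.log (Module.finrank ℂ Z)) ∧
      ∀ n, ∃ u, HasSchmidtRank (S₀ * R ^ n) u ∧
        ‖ψ - u‖ ^ 2 ≤ 64 * (n * δ n) + 18 * (1 / 4) ^ n := by
  have hδ : ∀ n, 0 ≤ δ n := fun n => (happ n).nonneg hψ hψ1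
  obtain ⟨n₀, hn₀, hδ₀, hn₀M⟩ := exists_small_index hM
  have hD : 1 ≤ Module.finrank ℂ Z := by
    refine Nat.one_le_iff_ne_zero.2 fun h => ?_
    rw [Submodule.finrank_eq_zero] at h
    rw [h, Submodule.mem_bot] at hψ
    simp [hψ] at hψ1
  set D := Module.finrank ℂ Z
  obtain ⟨m, hm, hmlog⟩ := exists_power R D hR hD
  have hR' : (1 : ℝ) ≤ R := by exact_mod_cast hR
  have hσ0 : 0 ≤ 1 / (2 * (R : ℝ)) := by positivity
  have hσ : 1 / (2 * (R : ℝ)) ≤ 1 / 2 := by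
    rw [div_le_div_iff₀ (by positivity) (by norm_num)]; linarith
  obtain ⟨hfin, hdD⟩ := (happ n₀).2.finiteDimensional (by linarith)
  obtain ⟨U, hU⟩ := (hK n₀ hn₀).exists_lift (m := m) (by positivity)
    ((pow_le_of_le_one hσ0 (by linarith) (by omega)).trans hσ) (lift_condition hR hdD hn₀ hm)
  refine ⟨D * (R ^ n₀) ^ m, ?_, ?_, ?_, fun n => ?_⟩
  · exact Nat.mul_pos hD (Nat.pow_pos (Nat.pow_pos hR))
  · rintro rfl; simp
  · have hD' : (0 : ℝ) < D := by exact_mod_cast hD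
    have hlR : 0 ≤ Real.log R := Real.log_nonneg hR'
    have hlD : 0 ≤ Real.log D := Real.log_nonneg (by exact_mod_cast hD)
    push_cast
    rw [Real.log_mul (by positivity) (by positivity), Real.log_pow, Real.log_pow]
    have h1 : (m : ℝ) * (n₀ * Real.log R) ≤ n₀ * (17 * (Real.log R + Real.log D)) := by
      rw [mul_left_comm]
      exact mul_le_mul_of_nonneg_left (by linarith) (Nat.cast_nonneg _)
    have h2 : (n₀ : ℝ) * (17 * (Real.log R + Real.log D)) ≤
        (64 * M + 1) * (17 * (Real.log R + Real.log D)) := by gcongr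
    linarith
  · rcases Nat.eq_zero_or_pos n with rfl | hn
    · exact ⟨0, hasSchmidtRank_zero.mono (Nat.zero_le _), by simp [hψ1]⟩
    have hn1 : (1 : ℝ) ≤ n := by exact_mod_cast hn
    have hδn : δ n ≤ n * δ n := le_mul_of_one_le_left (hδ n) hn1
    have h4 : (0 : ℝ) ≤ (1 / 4) ^ n := by positivity
    by_cases hδ1 : δ n ≤ 1 / 64
    · obtain ⟨hfin', -⟩ := (happ n).2.finiteDimensional (by linarith)
      obtain ⟨u, hu, hun⟩ := exists_approx_of_lift
        (fun y => ⟨(hU y).1, (hU y).2.mono (Nat.mul_le_mul_right _ hdD)⟩)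
        (happ n₀).1 (happ n) hδ₀ hδ1 (hK n hn) (by positivity) hψ hψ1
      refine ⟨u, hu, hun.trans ?_⟩
      have h5 : ((1 / (2 * (R : ℝ))) ^ n) ^ 2 ≤ (1 / 4) ^ n := by
        rw [← pow_mul, mul_comm n 2, pow_mul]
        refine pow_le_pow_left₀ (by positivity) ?_ n
        nlinarith
      have := hδ n
      linarith
    -- When `δ n > 1 / 64` the zero vector suffices: its squared error is `1 ≤ 64 * (n * δ n)`. This
    -- is why the error bound carries the factor 64.
    · refine ⟨0, hasSchmidtRank_zero.mono (Nat.zero_le _), ?_⟩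
      rw [sub_zero, hψ1]
      push Not at hδ1
      linarith

end Main

end Bipartite

theorem mainTheorem9 (M : ℝ) :
    ∃ C : ℝ, ∀ (H₁ : Type u) (H₂ : Type v)
      [NormedAddCommGroup H₁] [InnerProductSpace ℂ H₁] [CompleteSpace H₁]
      [NormedAddCommGroup H₂] [InnerProductSpace ℂ H₂] [CompleteSpace H₂]
      (Z : Submodule ℂ (Bipartite H₁ H₂)) [FiniteDimensional ℂ Z]
      (Z' : ℕ → Submodule ℂ (Bipartite H₁ H₂)) (δ : ℕ → ℝ)
      (R : ℕ) (K : ℕ → Bipartite H₁ H₂ →L[ℂ] Bipartite H₁ H₂),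
      1 ≤ R →
      (∀ n, Bipartite.ApproxEq (δ n) (Z' n) Z) →
      Summable (fun n : ℕ => (n : ℝ) * δ n) →
      ∑' n : ℕ, (n : ℝ) * δ n ≤ M →
      (∀ n, 1 ≤ n → Bipartite.IsAGSP ((1 / (2 * (R : ℝ))) ^ n) (R ^ n) (Z' n) (K n)) →
      ∀ ψ ∈ Z, ‖ψ‖ = 1 →
        Bipartite.entanglementEntropy ψ ≤
          ENNReal.ofReal (C * (Real.log R + Real.log (Module.finrank ℂ Z))) := by
  refine ⟨2 * (17 * (64 * M + 1) + 1) + 2 * (64 * M + 24) + 4, ?_⟩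
  intro H₁ H₂ _ _ _ _ _ _ Z _ Z' δ R K hR happ hsum hM hK ψ hψ hψ1
  have hδ : ∀ n, 0 ≤ δ n := fun n => (happ n).nonneg hψ hψ1
  have hM' : ∀ N, ∑ n ∈ Finset.range N, (n : ℝ) * δ n ≤ M := fun N =>
    (hsum.sum_le_tsum _ fun n _ => mul_nonneg (Nat.cast_nonneg n) (hδ n)).trans hM
  have hM0 : 0 ≤ M := by simpa using hM' 0
  obtain ⟨S₀, hS1, hSR, hSlog, happrox⟩ :=
    Bipartite.exists_approximations hR happ hM' hK hψ hψ1
  have hgeo : HasSum (fun n : ℕ => (1 / 4 : ℝ) ^ n) (4 / 3) := by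
    convert hasSum_geometric_of_lt_one (r := (1 / 4 : ℝ)) (by norm_num) (by norm_num) using 1
    norm_num
  have hτ : Filter.Tendsto (fun n : ℕ => 64 * (n * δ n) + 18 * (1 / 4 : ℝ) ^ n)
      Filter.atTop (nhds 0) := by
    simpa using (hsum.tendsto_atTop_zero.const_mul 64).add
      (hgeo.summable.tendsto_atTop_zero.const_mul 18)
  have hT : ∀ N, ∑ n ∈ Finset.range N, (64 * (n * δ n) + 18 * (1 / 4 : ℝ) ^ n) ≤
      64 * M + 24 := fun N => by
    rw [Finset.sum_add_distrib, ← Finset.mul_sum, ← Finset.mul_sum]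
    have := sum_le_hasSum (Finset.range N) (fun n _ => by positivity) hgeo
    linarith [hM' N]
  set D := Module.finrank ℂ Z with hDdef
  have hlR : 0 ≤ Real.log R := Real.log_natCast_nonneg R
  have hlD : 0 ≤ Real.log D := Real.log_natCast_nonneg D
  -- Here the claimed bound is zero, so the additive two in the entropy estimate is not affordable;
  -- instead `ψ` is a limit of product vectors. Otherwise `log R + log D ≥ 1 / 2` absorbs it, whence
  -- the summand 4 in the constant.
  by_cases hRD : R = 1 ∧ D = 1
  · obtain ⟨rfl, hD⟩ := hRD
    rw [Bipartite.entanglementEntropy_eq_zero_of_mem_closure ?_ hψ1]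
    · exact bot_le
    rw [Metric.mem_closure_iff]
    intro ε hε
    obtain ⟨n, hn⟩ := (hτ.eventually_lt_const (show (0 : ℝ) < ε ^ 2 by positivity)).exists
    obtain ⟨u, hu, hun⟩ := happrox n
    refine ⟨u, by simpa [hSR rfl, hD] using hu, ?_⟩
    rw [dist_eq_norm]
    exact lt_of_pow_lt_pow_left₀ 2 hε.le (hun.trans_lt hn)
  · refine (Bipartite.entanglementEntropy_le_of_approx hψ1 hS1 hR hτ hT happrox).trans
      (ENNReal.ofReal_le_ofReal ?_)
    have hD1 : 1 ≤ D := by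
      refine Nat.one_le_iff_ne_zero.2 fun h => ?_
      rw [hDdef, Submodule.finrank_eq_zero] at h
      rw [h, Submodule.mem_bot] at hψ
      simp [hψ] at hψ1
    have hL : 1 / 2 ≤ Real.log R + Real.log D := by
      have hl2 : 1 / 2 ≤ Real.log 2 := by linarith [Real.log_two_gt_d9]
      rcases (by omega : 2 ≤ R ∨ 2 ≤ D) with h | h
      · have := Real.log_le_log (by norm_num) (show (2 : ℝ) ≤ R by exact_mod_cast h)
        linarith
      · have := Real.log_le_log (by norm_num) (show (2 : ℝ) ≤ D by exact_mod_cast h)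
        linarith
    have h1 : (64 * M + 24) * Real.log R ≤ (64 * M + 24) * (Real.log R + Real.log D) := by
      gcongr
      linarith
    linarith
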